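/- Let $k\ge1$, let $\mathcal I=\{(i,j):1\le i,j\le k,\ i+j-1\le k\}$ and $\mathcal J=\{(i,j):1\le i,j\le k,\ i+j-1\ge k+1\}$ be the upper and lower run-off triangles, and let $n=k(k+1)/2=|\mathcal I|$. Let $p<n$, let $X_{ij}\in\mathbb R^p$, $(i,j)\in\mathcal I\cup\mathcal J$, be known design vectors, let $X$ be the $n\times p$ matrix with rows $X_{ij}'$, $(i,j)\in\mathcal I$, and let $\xi\in\mathbb R^p$ be fixed, where $\xi$ is identified by the normal likelihood of a regression on $X$, that is, $X$ has full column rank. (An example, for $k\ge3$, is the chain-ladder design $X_{ij}'=(1,1_{(2\le i)},\dots,1_{(k\le i)},1_{(2\le j)},\dots,1_{(k\le j)})$ with $p=2k-1$.) Consider a family of models (a sequence or, more generally, a family with a limit along a countably generated filter), possibly on different probability spaces, with $\omega>0$ and random variables $Y_{ij}$, $(i,j)\in\mathcal I\cup\mathcal J$, which follow the generalized log-normal model on both triangles: the $Y_{ij}$ are jointly independent over $\mathcal I\cup\mathcal J$, non-negative, infinitely divisible, with finite third moments and positive means, $\log\mathsf E(Y_{ij})=X_{ij}'\xi+\omega^2/2$,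 and asymptotically, with $k$, $p$, the $X_{ij}$ and $\xi$ fixed, for all $(i,j)\in\mathcal I\cup\mathcal J$, $$\omega^2\to0,\qquad \mathsf{skew}(Y_{ij})=\mathsf E\Big[\Big\{\frac{Y_{ij}-\mathsf E(Y_{ij})}{\sqrt{\mathsf{Var}(Y_{ij})}}\Big\}^3\Big]\to0,\qquad \frac{\mathsf{Var}(Y_{ij})}{\omega^2\{\mathsf E(Y_{ij})\}^2}\to1 .$$ Let $y$ be the vector of the $y_{ij}=\log Y_{ij}$, $(i,j)\in\mathcal I$ (with $\log 0:=0$, say; the event that some $Y_{ij}=0$ has vanishing probability), and let $\hat\xi=(X'X)^{-1}X'y$ and $\hat\omega^2=s^2=\frac1{n-p}\sum_{(i,j)\in\mathcal I}(y_{ij}-X_{ij}'\hat\xi)^2$. For $\mathcal A\subseteq\mathcal J$ let $Y_{\mathcal A}=\sum_{(i,j)\in\mathcal A}Y_{ij}$ and $\tilde Y_{\mathcal A}=\sum_{(i,j)\in\mathcal A}\exp(X_{ij}'\hat\xi+s^2/2)$. Then $$\hat\omega^{-1}(Y_{\mathcal A}-\tilde Y_{\mathcal A})\ \overset{\mathsf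 D}{\to}\ (\varsigma^2_{\mathcal A,process}+\varsigma^2_{\mathcal A,estimation})^{1/2}\,\mathsf t_{n-p}$$ (with $\hat\omega^{-1}:=0$, say, on the event $\hat\omega=0$, which has vanishing probability), where $\mathsf t_{n-p}$ is Student's $t$ distribution with $n-p$ degrees of freedom and $$\varsigma^2_{\mathcal A,process}=\sum_{(i,j)\in\mathcal A}\exp(2X_{ij}'\xi),\qquad \varsigma^2_{\mathcal A,estimation}=\Big\{\sum_{(i,j)\in\mathcal A}\exp(X_{ij}'\xi)X_{ij}'\Big\}(X'X)^{-1}\Big\{\sum_{(i,j)\in\mathcal A}\exp(X_{ij}'\xi)X_{ij}\Big\}.$$ Moreover the two variances are estimated consistently by the same expressions with $\hat\xi$ in place of $\xi$, $$r^2_{\mathcal A,process}=\sum_{(i,j)\in\mathcal A}\exp(2X_{ij}'\hat\xi),\qquad r^2_{\mathcal A,estimation}=\Big\{\sum_{(i,j)\in\mathcal A}\exp(X_{ij}'\hat\xi)X_{ij}'\Big\}(X'X)^{-1}\Big\{\sum_{(i,j)\in\mathcal A}\exp(X_{ij}'\hat\xi)X_{ij}\Big\},$$ that is, $r^2_{\mathcal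 A,process}\to\varsigma^2_{\mathcal A,process}$ and $r^2_{\mathcal A,estimation}\to\varsigma^2_{\mathcal A,estimation}$ in probability. -/

import Mathlib

open MeasureTheory ProbabilityTheory Filter Topology
open scoped Matrix

noncomputable section

namespace LogNormalCL

/-! ### Run-off triangles -/

/-- The upper triangle `𝓘` of dimension `k`: pairs `(i, j)` (origin year, development year) with
`1 ≤ i, j ≤ k` and `1 ≤ i + j - 1 ≤ k`. -/
def upperTriangle (k : ℕ) : Finset (ℕ × ℕ) :=
  (Finset.Icc 1 k ×ˢ Finset.Icc 1 k).filter fun c => c.1 + c.2 ≤ k + 1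

/-- The lower triangle `𝓙` of dimension `k`: pairs `(i, j)` with `1 ≤ i, j ≤ k` and
`k + 1 ≤ i + j - 1 ≤ 2 k - 1`. -/
def lowerTriangle (k : ℕ) : Finset (ℕ × ℕ) :=
  (Finset.Icc 1 k ×ˢ Finset.Icc 1 k).filter fun c => k + 2 ≤ c.1 + c.2

/-- The number of observations in the upper triangle. -/
def numObs (k : ℕ) : ℕ := k * (k + 1) / 2

/-! ### Least squares regression of the log claims on the upper triangle -/

section LeastSquares

variable {p : ℕ} (k : ℕ) (X : ℕ × ℕ → Fin p → ℝ)

/-- The linear predictor `μ_{ij} = X_{ij}' ξ`. -/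
def predictor (ξ : Fin p → ℝ) (c : ℕ × ℕ) : ℝ := X c ⬝ᵥ ξ

/-- The design matrix: the row vectors `X_{ij}'` stacked over the upper triangle. -/
def designMatrix : Matrix (upperTriangle k) (Fin p) ℝ :=
  Matrix.of fun c => X c

/-- The normal log likelihood of the log observations `y` at `(ξ, ω²) = (ξ, v)`. -/
def logLikelihood (y : upperTriangle k → ℝ) (ξ : Fin p → ℝ) (v : ℝ) : ℝ :=
  -((numObs k : ℝ) / 2) * Real.log (2 * Real.pi * v)
    - 1 / (2 * v) * ∑ c : upperTriangle k, (y c - predictor X ξ c) ^ 2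

/-- `ξ` is identified by the normal likelihood of the upper triangle: different values of `ξ`
give different likelihood functions (for whatever values of the variance). -/
def Identified : Prop :=
  ∀ ξ ξ' : Fin p → ℝ, ∀ v v' : ℝ, 0 < v → 0 < v' →
    (∀ y, logLikelihood k X y ξ v = logLikelihood k X y ξ' v') → ξ = ξ'

/-- The least squares estimator `ξ̂ = (X'X)⁻¹ X'y`. -/
def olsEstimator (y : upperTriangle k → ℝ) : Fin p → ℝ :=
  ((designMatrix k X)ᵀ * designMatrix k X)⁻¹ *ᵥ ((designMatrix k X)ᵀ *ᵥ y)

/-- The residual sum of squares. -/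
def rss (y : upperTriangle k → ℝ) : ℝ :=
  ∑ c : upperTriangle k, (y c - predictor X (olsEstimator k X y) c) ^ 2

/-- The variance estimator `s² = RSS / (n - p)`. -/
def sSq (y : upperTriangle k → ℝ) : ℝ :=
  rss k X y / ((numObs k : ℝ) - (p : ℝ))

/-- The point forecast `Ỹ_𝓐 = ∑_{(i,j) ∈ 𝓐} exp (X_{ij}' ξ̂ + s² / 2)`. -/
def pointForecast (A : Finset (ℕ × ℕ)) (y : upperTriangle k → ℝ) : ℝ :=
  ∑ c ∈ A, Real.exp (predictor X (olsEstimator k X y) c + sSq k X y / 2)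

/-- `∑_{(i,j) ∈ 𝓐} exp (2 X_{ij}' ξ)`: the process variance `ς²` at the true parameter, and its
estimator `r²` at `ξ̂`. -/
def processVar (A : Finset (ℕ × ℕ)) (ξ : Fin p → ℝ) : ℝ :=
  ∑ c ∈ A, Real.exp (2 * predictor X ξ c)

/-- `{∑_𝓐 exp (X_{ij}' ξ) X_{ij}'} (X'X)⁻¹ {∑_𝓐 exp (X_{ij}' ξ) X_{ij}}`: the estimation variance
`ς²` at the true parameter, and its estimator `r²` at `ξ̂`. -/
def estimationVar (A : Finset (ℕ × ℕ)) (ξ : Fin p → ℝ) : ℝ :=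
  (∑ c ∈ A, Real.exp (predictor X ξ c) • X c) ⬝ᵥ
    (((designMatrix k X)ᵀ * designMatrix k X)⁻¹ *ᵥ
      (∑ c ∈ A, Real.exp (predictor X ξ c) • X c))

end LeastSquares

/-- The log observations `y_{ij} = log Y_{ij}` of the upper triangle. -/
def logData {Ω : Type*} (k : ℕ) (Y : ℕ × ℕ → Ω → ℝ) (w : Ω) : upperTriangle k → ℝ :=
  fun c => Real.log (Y c w)

/-- The chain-ladder design
`X_{ij}' = (1, 1_{(2 ≤ i)}, …, 1_{(k ≤ i)}, 1_{(2 ≤ j)}, …, 1_{(k ≤ j)})`, with `p = 2 k - 1`. -/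
def chainLadderDesign (k : ℕ) (c : ℕ × ℕ) : Fin (2 * k - 1) → ℝ := fun m =>
  if (m : ℕ) = 0 then 1
  else if (m : ℕ) < k then (if (m : ℕ) + 1 ≤ c.1 then 1 else 0)
  else (if (m : ℕ) - k + 2 ≤ c.2 then 1 else 0)

/-! ### Probabilistic notions -/

/-- A distribution on `ℝ` is infinitely divisible if, for every `m ≥ 1`, it is the law of the sum
of `m` independent identically distributed random variables. -/
def InfinitelyDivisible (μ : Measure ℝ) : Prop :=
  ∀ m : ℕ, 0 < m → ∃ ν : Measure ℝ, IsProbabilityMeasure ν ∧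
    (Measure.pi fun _ : Fin m => ν).map (fun x => ∑ i, x i) = μ

/-- The skewness `E [{(Z - E Z) / sdv Z}³]`. -/
def skewness {Ω : Type*} [MeasurableSpace Ω] (P : Measure Ω) (Z : Ω → ℝ) : ℝ :=
  ∫ w, ((Z w - ∫ w', Z w' ∂P) / √(Var[Z; P])) ^ 3 ∂P

/-- The `χ²` distribution with `ν` degrees of freedom: the law of the sum of the squares of `ν`
independent standard normal variables. -/
def chiSquared (ν : ℕ) : Measure ℝ :=
  (Measure.pi fun _ : Fin ν => gaussianReal 0 1).map (fun z => ∑ i, z i ^ 2)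

instance (ν : ℕ) : IsProbabilityMeasure (chiSquared ν) :=
  Measure.isProbabilityMeasure_map
    (Finset.measurable_sum _ fun i _ => (measurable_pi_apply i).pow_const 2).aemeasurable

/-- Student's `t` distribution with `ν` degrees of freedom: the law of `Z / √(V / ν)` with `Z`
standard normal, `V` distributed as `χ²` with `ν` degrees of freedom, and `Z`, `V` independent. -/
def studentT (ν : ℕ) : Measure ℝ :=
  ((gaussianReal 0 1).prod (chiSquared ν)).map (fun x => x.1 / √(x.2 / (ν : ℝ)))

instance (ν : ℕ) : IsProbabilityMeasure (studentT ν) :=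
  Measure.isProbabilityMeasure_map (by fun_prop)

section Models

/- A family of probability spaces, indexed by `τ : ι`, with limits taken along the filter `l`. -/
variable {ι : Type*} {Ω : ι → Type*} [∀ τ, MeasurableSpace (Ω τ)]

/-- Convergence in probability to a constant, for variables on varying probability spaces. -/
def TendstoInProbability (Z : (τ : ι) → Ω τ → ℝ) (l : Filter ι) (a : ℝ)
    (P : (τ : ι) → Measure (Ω τ)) : Prop :=
  ∀ ε : ℝ, 0 < ε → Tendsto (fun τ => P τ {w | ε ≤ |Z τ w - a|}) l (𝓝 0)

/-- Infinite divisibility assumption for the array `Y_{ij}`, `(i, j) ∈ S`. The index set `S` is the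
same for all `τ`. The third moment, hence the skewness, is finite. -/
structure InfinitelyDivisibleArray (S : Finset (ℕ × ℕ)) (l : Filter ι)
    (P : (τ : ι) → Measure (Ω τ)) (Y : (τ : ι) → ℕ × ℕ → Ω τ → ℝ) : Prop where
  measurable : ∀ τ, ∀ c ∈ S, Measurable (Y τ c)
  independent : ∀ τ, iIndepFun (fun c : S => Y τ c) (P τ)
  nonneg : ∀ τ, ∀ c ∈ S, ∀ᵐ w ∂(P τ), 0 ≤ Y τ c w
  infinitelyDivisible : ∀ τ, ∀ c ∈ S, InfinitelyDivisible ((P τ).map (Y τ c))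
  third_moment : ∀ τ, ∀ c ∈ S, MemLp (Y τ c) 3 (P τ)
  skewness_tendsto : ∀ c ∈ S, Tendsto (fun τ => skewness (P τ) (Y τ c)) l (𝓝 0)

/-- The generalized log-normal model for the array `Y_{ij}`, `(i, j) ∈ S`, with predictor
`X_{ij}' ξ`, where `ξ` does not depend on `τ`, and dispersion `ω τ`. -/
structure GeneralizedLogNormal {p : ℕ} (k : ℕ) (S : Finset (ℕ × ℕ)) (X : ℕ × ℕ → Fin p → ℝ)
    (ξ : Fin p → ℝ) (ω : ι → ℝ) (l : Filter ι)
    (P : (τ : ι) → Measure (Ω τ)) (Y : (τ : ι) → ℕ × ℕ → Ω τ → ℝ) : Prop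
    extends InfinitelyDivisibleArray S l P Y where
  identified : Identified k X
  mean_pos : ∀ τ, ∀ c ∈ S, 0 < ∫ w, Y τ c w ∂(P τ)
  log_mean : ∀ τ, ∀ c ∈ S,
    Real.log (∫ w, Y τ c w ∂(P τ)) = predictor X ξ c + ω τ ^ 2 / 2
  omega_pos : ∀ τ, 0 < ω τ
  omega_tendsto : Tendsto (fun τ => ω τ ^ 2) l (𝓝 0)
  variance_ratio : ∀ c ∈ S,
    Tendsto (fun τ => Var[Y τ c; P τ] / (ω τ ^ 2 * (∫ w, Y τ c w ∂(P τ)) ^ 2)) l (𝓝 1)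

end Models

/-! ### Checks on the definitions -/

theorem card_upperTriangle (k : ℕ) : (upperTriangle k).card = numObs k := by
  have h : upperTriangle k
      = (Finset.range k).biUnion (fun i => (Finset.Icc 1 (k - i)).image (fun j => (i + 1, j))) := by
    ext ⟨a, b⟩
    simp only [upperTriangle, Finset.mem_filter, Finset.mem_product, Finset.mem_Icc,
      Finset.mem_biUnion, Finset.mem_range, Finset.mem_image, Prod.mk.injEq]
    constructor
    · rintro ⟨⟨⟨h1, h2⟩, h3, h4⟩, h5⟩
      exact ⟨a - 1, by omega, b, ⟨h3, by omega⟩, by omega, rfl⟩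
    · rintro ⟨i, hi, j, ⟨h1, h2⟩, h3, h4⟩
      omega
  rw [h, Finset.card_biUnion]
  · have h2 : ∀ i ∈ Finset.range k,
        ((Finset.Icc 1 (k - i)).image (fun j => (i + 1, j))).card = k - i := by
      intro i _
      rw [Finset.card_image_of_injective _ (fun a b hab => (Prod.mk.inj hab).2)]
      simp
    rw [Finset.sum_congr rfl h2, numObs]
    have h3 := Finset.sum_range_reflect (fun i => i + 1) k
    have h4 : ∑ j ∈ Finset.range k, (k - 1 - j + 1) = ∑ j ∈ Finset.range k, (k - j) :=
      Finset.sum_congr rfl (fun j hj => by have := Finset.mem_range.1 hj; omega)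
    rw [← h4, h3]
    have h5 := Finset.sum_range_id_mul_two (k + 1)
    rw [Finset.sum_range_succ'] at h5
    simp only [Nat.add_sub_cancel, add_zero] at h5
    rw [mul_comm k, ← h5]
    simp
  · intro i _ j _ hij
    rw [Function.onFun, Finset.disjoint_left]
    simp only [Finset.mem_image]
    rintro x ⟨a, _, rfl⟩ ⟨b, _, hb⟩
    exact hij (by have := (Prod.mk.inj hb).1; omega)

theorem identified_iff {p : ℕ} (k : ℕ) (X : ℕ × ℕ → Fin p → ℝ) :
    Identified k X ↔ Function.Injective (designMatrix k X).mulVec := by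
  have key : ∀ (ξ : Fin p → ℝ) (c : upperTriangle k),
      (designMatrix k X).mulVec ξ c = predictor X ξ c := fun _ _ => rfl
  constructor
  · intro h ξ ξ' e
    refine h ξ ξ' 1 1 one_pos one_pos fun y => ?_
    have : ∀ c : upperTriangle k, predictor X ξ c = predictor X ξ' c := fun c => by
      rw [← key, ← key, e]
    simp only [logLikelihood, this]
  · intro h ξ ξ' v v' hv hv' e
    apply h
    have e1 := e ((designMatrix k X).mulVec ξ)
    have e2 := e ((designMatrix k X).mulVec ξ')
    simp only [logLikelihood, key, sub_self, ne_eq, OfNat.ofNat_ne_zero, not_false_eq_true,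
      zero_pow, Finset.sum_const_zero, mul_zero, sub_zero] at e1 e2
    have hsym : ∑ c : upperTriangle k, (predictor X ξ' c - predictor X ξ c) ^ 2
        = ∑ c : upperTriangle k, (predictor X ξ c - predictor X ξ' c) ^ 2 :=
      Finset.sum_congr rfl fun c _ => by ring
    rw [hsym] at e2
    set D := ∑ c : upperTriangle k, (predictor X ξ c - predictor X ξ' c) ^ 2 with hD
    have hD0 : 0 ≤ D := Finset.sum_nonneg fun c _ => sq_nonneg _
    have p1 : 0 < 1 / (2 * v) := by positivity
    have p2 : 0 < 1 / (2 * v') := by positivity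
    have hz : (1 / (2 * v) + 1 / (2 * v')) * D = 0 := by linarith
    have hD' : D = 0 := by
      rcases mul_eq_zero.1 hz with h0 | h0
      · linarith
      · exact h0
    funext c
    rw [key, key]
    have := (Finset.sum_eq_zero_iff_of_nonneg (fun c _ => sq_nonneg _)).1 hD' c (Finset.mem_univ c)
    exact sub_eq_zero.1 (pow_eq_zero_iff (two_ne_zero) |>.1 this)

/-- The chain-ladder design is identified by the upper triangle. -/
theorem identified_chainLadderDesign (k : ℕ) : Identified k (chainLadderDesign k) := by
  rw [identified_iff]
  intro ξ ξ' e
  have key : ∀ i j : ℕ, 1 ≤ i → 1 ≤ j → i + j ≤ k + 1 →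
      chainLadderDesign k (i, j) ⬝ᵥ (ξ - ξ') = 0 := by
    intro i j hi hj hij
    have hm : (i, j) ∈ upperTriangle k := by
      simp only [upperTriangle, Finset.mem_filter, Finset.mem_product, Finset.mem_Icc]
      omega
    have := congrFun e ⟨(i, j), hm⟩
    rw [dotProduct_sub]
    exact sub_eq_zero.2 this
  have diff : ∀ (i j i' j' : ℕ) (m : Fin (2 * k - 1)), 1 ≤ i → 1 ≤ j → i + j ≤ k + 1 →
      1 ≤ i' → 1 ≤ j' → i' + j' ≤ k + 1 →
      chainLadderDesign k (i, j) - chainLadderDesign k (i', j') = Pi.single m 1 →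
      ξ m = ξ' m := by
    intro i j i' j' m h1 h2 h3 h4 h5 h6 h7
    have h8 : (Pi.single m 1 : Fin (2 * k - 1) → ℝ) ⬝ᵥ (ξ - ξ') = 0 := by
      rw [← h7, sub_dotProduct, key i j h1 h2 h3, key i' j' h4 h5 h6, sub_zero]
    rw [single_one_dotProduct, Pi.sub_apply] at h8
    exact sub_eq_zero.1 h8
  funext m
  have hm := m.2
  by_cases h0 : (m : ℕ) = 0
  · have h8 : (Pi.single m 1 : Fin (2 * k - 1) → ℝ) ⬝ᵥ (ξ - ξ') = 0 := by
      rw [← key 1 1 le_rfl le_rfl (by omega)]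
      congr 1
      funext q
      simp only [chainLadderDesign, Pi.single_apply, Fin.ext_iff]
      split_ifs <;> first | rfl | omega
    rw [single_one_dotProduct, Pi.sub_apply] at h8
    exact sub_eq_zero.1 h8
  · by_cases h1 : (m : ℕ) < k
    · refine diff (m + 1) 1 m 1 m (by omega) le_rfl (by omega) (by omega) le_rfl (by omega) ?_
      funext q
      simp only [chainLadderDesign, Pi.single_apply, Fin.ext_iff, Pi.sub_apply]
      split_ifs <;> first | omega | norm_num
    · refine diff 1 (m - k + 2) 1 (m - k + 1) m le_rfl (by omega) (by omega) le_rfl (by omega)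
        (by omega) ?_
      funext q
      simp only [chainLadderDesign, Pi.single_apply, Fin.ext_iff, Pi.sub_apply]
      split_ifs <;> first | omega | norm_num

/-- The chain-ladder design leaves a positive number of degrees of freedom as soon as `k ≥ 3`. -/
theorem chainLadder_lt_numObs {k : ℕ} (hk : 3 ≤ k) : 2 * k - 1 < numObs k := by
  obtain ⟨m, rfl⟩ := Nat.exists_eq_add_of_le hk
  have h : 2 * (2 * m + 6) ≤ (3 + m) * (3 + m + 1) := by nlinarith
  rw [numObs]
  omega

end LogNormalCL

end

namespace LogNormalCL

/-! ### Convergence in distribution -/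

/-! Put `z = (Y - E Y) / (ω E Y)` for each cell. Since `E Y = exp (X'ξ + ω²/2)`, the claims are
exactly `exp (X'ξ + ω²/2) (1 + ω z)`, so every statistic in question is a function of the pair `(ω,
z)`. It remains to find the limit law of `z` and to extend these functions to `ω = 0`.

Each `z` is asymptotically standard normal. A non-negative infinitely divisible variable is a sum of
`m` iid non-negative variables for every `m`. Non-negativity lets the skewness, which involves
signed cubes, control the sum of absolute third moments up to a term of order `m⁻²`. Letting `m → ∞`
gives a distance of at most `4|t|³ skew` between characteristic functions
(`norm_charFun_standardized_sub_le`). Independence makes the convergence joint.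

The studentized error has a removable singularity at `ω = 0`: least squares is equivariant, so
numerator and `s` both carry a factor `ω`, which cancels. The remainder, written with `dslope`, is
continuous at `(0, z)` whenever `s²(z) > 0`, hence almost surely in the limit, and the continuous
mapping theorem applies (`studentizedError_scaledClaims`, `continuousAt_studentizedExpansion`).

At `ω = 0` a linear form in a standard normal vector is divided by a residual standard error. Its
weights on the upper triangle lie in the column space of the design, orthogonal to the residuals,
and its squared norm is process plus estimation variance; this gives the scaled `t` law
(`map_studentizedExpansion_zero`). Consistency of the variance estimators follows in the same way
from `ξ̂ = ξ + ω · O(1)`. -/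

/-- The continuous mapping theorem: a function of variables which converge in distribution
converges in distribution, if the function is continuous almost everywhere for the limit law. -/
theorem tendstoInDistribution_of_ae_continuousAt {ι : Type*} {l : Filter ι}
    [l.IsCountablyGenerated] {Ω : ι → Type*} [∀ τ, MeasurableSpace (Ω τ)] {Ω' : Type*}
    [MeasurableSpace Ω'] {P : (τ : ι) → Measure (Ω τ)} [∀ τ, IsProbabilityMeasure (P τ)]
    {P' : Measure Ω'} [IsProbabilityMeasure P'] {E F : Type*}
    [TopologicalSpace E] [MeasurableSpace E] [OpensMeasurableSpace E] [HasOuterApproxClosed E]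
    [TopologicalSpace F] [MeasurableSpace F] [OpensMeasurableSpace F] [HasOuterApproxClosed F]
    {V : (τ : ι) → Ω τ → E} {Z : Ω' → E} (hV : TendstoInDistribution V l Z P P')
    {f : (τ : ι) → Ω τ → F} {h : Ω' → F} (hf : ∀ τ, AEMeasurable (f τ) (P τ))
    (hh : AEMeasurable h P') (g : E → F) (hfg : ∀ τ w, f τ w = g (V τ w))
    (hg : ∀ᵐ z ∂P', ContinuousAt g (Z z)) (hgh : ∀ᵐ z ∂P', g (Z z) = h z) :
    TendstoInDistribution f l h P P' where
  forall_aemeasurable := hf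
  aemeasurable_limit := hh
  tendsto := by
    refine tendsto_of_forall_isClosed_limsup_le' fun C hC => ?_
    -- `g` need not be measurable, so portmanteau is applied to the closure of the preimage. At a
    -- continuity point of `g`, lying in that closure already forces the value of `g` into `C`.
    have key := ProbabilityMeasure.limsup_measure_closed_le_of_tendsto hV.tendsto
      (isClosed_closure (s := g ⁻¹' C))
    refine le_trans (limsup_le_limsup (Eventually.of_forall fun τ => ?_)) (key.trans ?_)
    · simp only [ProbabilityMeasure.coe_mk]
      rw [Measure.map_apply_of_aemeasurable (hf τ) hC.measurableSet,
        Measure.map_apply_of_aemeasurable (hV.forall_aemeasurable τ) isClosed_closure.measurableSet]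
      refine measure_mono fun w hw => subset_closure ?_
      change g (V τ w) ∈ C
      rw [← hfg]
      exact hw
    · simp only [ProbabilityMeasure.coe_mk]
      rw [Measure.map_apply_of_aemeasurable hh hC.measurableSet,
        Measure.map_apply_of_aemeasurable hV.aemeasurable_limit isClosed_closure.measurableSet]
      refine measure_mono_ae ?_
      filter_upwards [hg, hgh] with z hz1 hz2 hz3
      change h z ∈ C
      rw [← hz2]
      have hz4 : ∃ᶠ x in 𝓝 (Z z), g x ∈ C := mem_closure_iff_frequently.1 hz3
      exact hC.mem_of_frequently_of_tendsto hz4 hz1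

theorem tendstoInProbability_of_tendstoInDistribution_const {ι : Type*} {l : Filter ι}
    {Ω : ι → Type*} [∀ τ, MeasurableSpace (Ω τ)] {Ω' : Type*} [MeasurableSpace Ω']
    {P : (τ : ι) → Measure (Ω τ)} [∀ τ, IsProbabilityMeasure (P τ)]
    {P' : Measure Ω'} [IsProbabilityMeasure P'] {f : (τ : ι) → Ω τ → ℝ} {a : ℝ}
    (hf : TendstoInDistribution f l (fun _ : Ω' => a) P P') :
    TendstoInProbability f l a P := by
  intro ε hε
  have hC : IsClosed {x : ℝ | ε ≤ |x - a|} := isClosed_le (by fun_prop) (by fun_prop)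
  have key := ProbabilityMeasure.limsup_measure_closed_le_of_tendsto hf.tendsto hC
  simp only [ProbabilityMeasure.coe_mk] at key
  have h0 : P'.map (fun _ => a) {x : ℝ | ε ≤ |x - a|} = 0 := by
    rw [Measure.map_apply measurable_const hC.measurableSet]
    simp [hε.not_ge]
  rw [h0] at key
  refine tendsto_of_le_liminf_of_limsup_le (by simp) ?_
  refine le_trans (le_of_eq (congrArg (fun q => limsup q l) (funext fun τ => ?_))) key
  rw [Measure.map_apply_of_aemeasurable (hf.forall_aemeasurable τ) hC.measurableSet]
  rfl

/-! ### A central limit theorem for infinitely divisible laws -/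

/-- The Taylor remainder serves for `|x| ≤ 1` and the triangle inequality for `|x| ≥ 1`; the
constant `4` is crude but covers both. -/
theorem norm_exp_mul_I_sub_taylor_two_le (x : ℝ) :
    ‖Complex.exp (x * Complex.I) - (1 + x * Complex.I - (x : ℂ) ^ 2 / 2)‖ ≤ 4 * |x| ^ 3 := by
  rcases le_total |x| 1 with hx | hx
  · have h := Complex.exp_bound (x := x * Complex.I) (by simpa using hx) (n := 3) (by norm_num)
    have e : ∑ m ∈ Finset.range 3, (x * Complex.I) ^ m / (m.factorial : ℂ)
        = 1 + x * Complex.I - (x : ℂ) ^ 2 / 2 := by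
      simp [Finset.sum_range_succ, mul_pow, Nat.factorial]
      ring
    rw [e] at h
    refine h.trans ?_
    simp only [norm_mul, Complex.norm_real, Complex.norm_I, mul_one, Real.norm_eq_abs]
    have : (0 : ℝ) ≤ |x| ^ 3 := by positivity
    norm_num [Nat.factorial]
    linarith
  · have h1 : ‖Complex.exp (x * Complex.I)‖ = 1 := Complex.norm_exp_ofReal_mul_I x
    have h2 : ‖(1 + x * Complex.I - (x : ℂ) ^ 2 / 2)‖ ≤ 1 + |x| + |x| ^ 2 / 2 := by
      refine (norm_sub_le _ _).trans (add_le_add ((norm_add_le _ _).trans ?_) ?_)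
      · simp
      · simp
    refine (norm_sub_le _ _).trans ?_
    nlinarith [mul_nonneg (sub_nonneg.2 hx) (sub_nonneg.2 hx), pow_le_pow_left₀ zero_le_one hx 2,
      mul_nonneg (sq_nonneg |x|) (sub_nonneg.2 hx)]

theorem norm_charFun_sub_le {ν : Measure ℝ} [IsProbabilityMeasure ν] (h3 : MemLp id 3 ν)
    (h0 : ∫ x, x ∂ν = 0) (t : ℝ) :
    ‖charFun ν t - ((1 - t ^ 2 * (∫ x, x ^ 2 ∂ν) / 2 : ℝ) : ℂ)‖
      ≤ 4 * |t| ^ 3 * ∫ x, |x| ^ 3 ∂ν := by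
  have i1 : Integrable (fun x : ℝ => x) ν := h3.integrable (by norm_num)
  have i2 : Integrable (fun x : ℝ => x ^ 2) ν :=
    (h3.mono_exponent (p := 2) (by norm_num)).integrable_sq
  have i3 : Integrable (fun x : ℝ => |x| ^ 3) ν := by
    simpa using h3.integrable_norm_pow (p := 3) (by norm_num)
  have ie : Integrable (fun x : ℝ => Complex.exp (↑(t * x) * Complex.I)) ν := by
    refine Integrable.of_bound (C := 1) (by fun_prop) (Eventually.of_forall fun x => ?_)
    rw [Complex.norm_exp_ofReal_mul_I]
  have ir : Integrable (fun x : ℝ => (1 + ((t * x : ℝ) : ℂ) * Complex.I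
      - ((t * x : ℝ) : ℂ) ^ 2 / 2)) ν := by
    refine ((integrable_const _).add ((i1.const_mul t).ofReal.mul_const _)).sub ?_
    have := ((i2.const_mul (t ^ 2)).ofReal (𝕜 := ℂ)).div_const 2
    refine this.congr (Eventually.of_forall fun x => ?_)
    simp [mul_pow]
  have e : ((1 - t ^ 2 * (∫ x, x ^ 2 ∂ν) / 2 : ℝ) : ℂ)
      = ∫ x, (1 + ((t * x : ℝ) : ℂ) * Complex.I - ((t * x : ℝ) : ℂ) ^ 2 / 2) ∂ν := by
    have e2 : ∀ x : ℝ, (1 + ((t * x : ℝ) : ℂ) * Complex.I - ((t * x : ℝ) : ℂ) ^ 2 / 2)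
        = ((1 - t ^ 2 * x ^ 2 / 2 : ℝ) : ℂ) + ((t * x : ℝ) : ℂ) * Complex.I := fun x => by
      push_cast; ring
    simp_rw [e2]
    rw [integral_add, integral_mul_const, integral_complex_ofReal, integral_complex_ofReal,
      integral_sub (integrable_const _) ((i2.const_mul _).div_const _), integral_div,
      integral_const_mul, integral_const_mul, h0]
    · simp
    · exact ((integrable_const (1 : ℝ)).sub ((i2.const_mul _).div_const _)).ofReal
    · exact (i1.const_mul t).ofReal.mul_const _
  have ec : charFun ν t = ∫ x, Complex.exp (↑(t * x) * Complex.I) ∂ν := by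
    rw [charFun_apply_real]
    simp
  rw [e, ec, ← integral_sub ie ir, ← integral_const_mul]
  refine norm_integral_le_of_norm_le (i3.const_mul _) (Eventually.of_forall fun x => ?_)
  refine (norm_exp_mul_I_sub_taylor_two_le (t * x)).trans (le_of_eq ?_)
  rw [abs_mul, mul_pow, mul_assoc]

/-- Telescoping inside the unit disc: an error in the characteristic function of one summand grows
at most by the factor `m` for the sum. -/
theorem norm_pow_sub_pow_le {a b : ℂ} (ha : ‖a‖ ≤ 1) (hb : ‖b‖ ≤ 1) (m : ℕ) :
    ‖a ^ m - b ^ m‖ ≤ m * ‖a - b‖ := by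
  induction m with
  | zero => simp
  | succ m ih =>
    have e : a ^ (m + 1) - b ^ (m + 1) = a * (a ^ m - b ^ m) + (a - b) * b ^ m := by ring
    rw [e]
    refine (norm_add_le _ _).trans ?_
    rw [norm_mul, norm_mul, norm_pow]
    have h1 : ‖a‖ * ‖a ^ m - b ^ m‖ ≤ 1 * (m * ‖a - b‖) :=
      mul_le_mul ha ih (norm_nonneg _) zero_le_one
    have h2 : ‖a - b‖ * ‖b‖ ^ m ≤ ‖a - b‖ * 1 :=
      mul_le_mul_of_nonneg_left (pow_le_one₀ (norm_nonneg _) hb) (norm_nonneg _)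
    push_cast
    linarith

/-- Third central moments are additive over independent variables. -/
theorem integral_sum_pow_three {ι Ω : Type*} [MeasurableSpace Ω] {P : Measure Ω}
    [IsProbabilityMeasure P] {W : ι → Ω → ℝ} (hm : ∀ i, Measurable (W i)) (hi : iIndepFun W P)
    (h3 : ∀ i, MemLp (W i) 3 P) (h0 : ∀ i, ∫ w, W i w ∂P = 0) (s : Finset ι) :
    ∫ w, (∑ i ∈ s, W i w) ^ 3 ∂P = ∑ i ∈ s, ∫ w, W i w ^ 3 ∂P := by
  classical
  induction s using Finset.induction_on with
  | empty => simp
  | insert a s ha ih =>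
    have hS3 : MemLp (fun w => ∑ i ∈ s, W i w) 3 P := memLp_finsetSum _ fun i _ => h3 i
    have hind : IndepFun (fun w => ∑ i ∈ s, W i w) (W a) P := by
      have := hi.indepFun_finsetSum_of_notMem hm ha
      rwa [show (∑ i ∈ s, W i) = fun w => ∑ i ∈ s, W i w by ext; simp] at this
    have hS0 : ∫ w, ∑ i ∈ s, W i w ∂P = 0 := by
      rw [integral_finsetSum _ fun i _ => (h3 i).integrable (by norm_num)]
      exact Finset.sum_eq_zero fun i _ => h0 i
    set S := fun w => ∑ i ∈ s, W i w with hS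
    have sq : ∀ {f : Ω → ℝ}, MemLp f 3 P → Integrable (fun w => f w ^ 2) P := fun h =>
      (h.mono_exponent (p := 2) (by norm_num)).integrable_sq
    have cube : ∀ {f : Ω → ℝ}, MemLp f 3 P → Integrable (fun w => f w ^ 3) P := fun h =>
      (MemLp.integrable_norm_pow h (p := 3) (by norm_num)).mono'
        (h.1.pow 3) (Eventually.of_forall fun w => by simp)
    have one : ∀ {f : Ω → ℝ}, MemLp f 3 P → Integrable f P := fun h => h.integrable (by norm_num)
    have ind1 : IndepFun (fun w => S w ^ 2) (W a) P :=
      hind.comp (φ := fun x => x ^ 2) (ψ := id) (by fun_prop) (by fun_prop)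
    have ind2 : IndepFun S (fun w => W a w ^ 2) P :=
      hind.comp (φ := id) (ψ := fun x => x ^ 2) (by fun_prop) (by fun_prop)
    have j1 : Integrable (fun w => S w ^ 2 * W a w) P :=
      ind1.integrable_mul (sq hS3) (one (h3 a))
    have j2 : Integrable (fun w => S w * W a w ^ 2) P :=
      ind2.integrable_mul (one hS3) (sq (h3 a))
    have c1 : Integrable (fun w => W a w ^ 3) P := cube (h3 a)
    have c2 : Integrable (fun w => S w ^ 3) P := cube hS3
    have c3 : Integrable (fun w => W a w ^ 3 + S w ^ 3) P := c1.add c2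
    have j3 : Integrable (fun w => 3 * (S w ^ 2 * W a w) + 3 * (S w * W a w ^ 2)) P :=
      (j1.const_mul 3).add (j2.const_mul 3)
    -- Each mixed term of the cube contains a centred factor to the first power, so independence
    -- makes it vanish.
    have v1 := ind1.integral_fun_mul_eq_mul_integral (sq hS3).1 (h3 a).1
    have v2 := ind2.integral_fun_mul_eq_mul_integral hS3.1 (sq (h3 a)).1
    rw [h0 a, mul_zero] at v1
    rw [hS0, zero_mul] at v2
    simp_rw [Finset.sum_insert ha]
    have e : ∀ w, (W a w + S w) ^ 3
        = (W a w ^ 3 + S w ^ 3) + (3 * (S w ^ 2 * W a w) + 3 * (S w * W a w ^ 2)) := fun w => by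
      ring
    change ∫ w, (W a w + S w) ^ 3 ∂P = _
    simp_rw [e]
    rw [integral_add c3 j3,
      integral_add c1 c2, integral_add (j1.const_mul 3) (j2.const_mul 3),
      integral_const_mul, integral_const_mul, v1, v2]
    simp only [mul_zero, add_zero]
    congr 1

/-! ### Convolution roots of a non-negative law. -/

section Root

variable {m : ℕ} {μ ν : Measure ℝ} [IsProbabilityMeasure ν]

/-- If a root charged the negative half-line, all `m` summands would be negative together with
positive probability. -/
theorem ae_nonneg_of_map_sum (hm : 0 < m)
    (hμ : (Measure.pi fun _ : Fin m => ν).map (fun x => ∑ i, x i) = μ)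
    (h0 : ∀ᵐ x ∂μ, 0 ≤ x) : ∀ᵐ x ∂ν, 0 ≤ x := by
  have hS : Measurable fun x : Fin m → ℝ => ∑ i, x i := by fun_prop
  have h1 : μ (Set.Iio 0) = 0 := by
    rw [ae_iff] at h0
    convert h0 using 2
    ext x; simp
  rw [← hμ, Measure.map_apply hS measurableSet_Iio] at h1
  have h2 : (Measure.pi fun _ : Fin m => ν) (Set.univ.pi fun _ => Set.Iio 0) = 0 := by
    refine measure_mono_null (fun x hx => ?_) h1
    have : Nonempty (Fin m) := ⟨⟨0, hm⟩⟩
    have hx' : ∀ i, x i < 0 := fun i => hx i (Set.mem_univ i)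
    exact Finset.sum_neg (fun i _ => hx' i) Finset.univ_nonempty
  rw [Measure.pi_pi, Finset.prod_const, Finset.card_univ, Fintype.card_fin] at h2
  rw [ae_iff]
  convert eq_zero_of_pow_eq_zero h2 using 2
  ext x; simp

/-- With non-negative summands each one is dominated by the sum, so moments pass from the sum to the
root. -/
theorem memLp_three_of_map_sum (hm : 0 < m)
    (hμ : (Measure.pi fun _ : Fin m => ν).map (fun x => ∑ i, x i) = μ)
    (h0 : ∀ᵐ x ∂μ, 0 ≤ x) (h3 : MemLp id 3 μ) : MemLp id 3 ν := by
  have hS : Measurable fun x : Fin m → ℝ => ∑ i, x i := by fun_prop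
  have hn := ae_nonneg_of_map_sum hm hμ h0
  have hn' : ∀ᵐ x ∂(Measure.pi fun _ : Fin m => ν), ∀ i, 0 ≤ x i :=
    ae_all_iff.2 fun i =>
      (measurePreserving_eval (fun _ : Fin m => ν) i).quasiMeasurePreserving.ae hn
  have hS3 : MemLp (fun x : Fin m → ℝ => ∑ i, x i) 3 (Measure.pi fun _ : Fin m => ν) := by
    rw [← hμ] at h3
    exact (memLp_map_measure_iff (by fun_prop) hS.aemeasurable).1 h3
  have h1 : MemLp (Function.eval (⟨0, hm⟩ : Fin m)) 3 (Measure.pi fun _ : Fin m => ν) := by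
    refine hS3.mono (measurable_pi_apply _).aestronglyMeasurable ?_
    filter_upwards [hn'] with x hx
    rw [Real.norm_of_nonneg (hx _), Real.norm_of_nonneg (Finset.sum_nonneg fun i _ => hx i)]
    exact Finset.single_le_sum (fun i _ => hx i) (Finset.mem_univ _)
  have := (measurePreserving_eval (fun _ : Fin m => ν) ⟨0, hm⟩)
  rw [← this.map_eq]
  exact (memLp_map_measure_iff aestronglyMeasurable_id this.measurable.aemeasurable).2 h1

theorem integral_of_map_sum
    (hμ : (Measure.pi fun _ : Fin m => ν).map (fun x => ∑ i, x i) = μ) (h3 : MemLp id 3 ν) :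
    ∫ x, x ∂μ = m * ∫ x, x ∂ν := by
  have i1 : Integrable (fun x : ℝ => x) ν := h3.integrable (by norm_num)
  rw [← hμ, integral_map (by fun_prop) (by fun_prop), integral_finsetSum]
  · simp_rw [fun i : Fin m => integral_comp_eval (μ := fun _ : Fin m => ν) (i := i)
      (f := fun x : ℝ => x) i1.1]
    simp
  · exact fun i _ => (measurePreserving_eval (fun _ : Fin m => ν) i).integrable_comp_of_integrable i1

theorem variance_of_map_sum
    (hμ : (Measure.pi fun _ : Fin m => ν).map (fun x => ∑ i, x i) = μ) (h3 : MemLp id 3 ν) :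
    Var[id; μ] = m * Var[id; ν] := by
  have h2 : MemLp id 2 ν := h3.mono_exponent (by norm_num)
  rw [← hμ, variance_map (by fun_prop) (by fun_prop)]
  have e : (id ∘ fun x : Fin m → ℝ => ∑ i, x i) = ∑ i, fun x : Fin m → ℝ => id (x i) := by
    ext x; simp
  rw [e, variance_sum_pi (fun _ => h2)]
  simp

theorem integral_pow_three_of_map_sum [IsProbabilityMeasure μ]
    (hμ : (Measure.pi fun _ : Fin m => ν).map (fun x => ∑ i, x i) = μ) (h3 : MemLp id 3 ν) :
    ∫ x, (x - ∫ y, y ∂μ) ^ 3 ∂μ = m * ∫ x, (x - ∫ y, y ∂ν) ^ 3 ∂ν := by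
  have ha := integral_of_map_sum hμ h3
  set a := ∫ y, y ∂μ
  set b := ∫ y, y ∂ν with hb
  have i1 : Integrable (fun x : ℝ => x) ν := h3.integrable (by norm_num)
  have h3' : MemLp (fun x : ℝ => x - b) 3 ν := h3.sub (memLp_const b)
  have mp := measurePreserving_eval (fun _ : Fin m => ν)
  rw [← hμ, integral_map (by fun_prop) (by fun_prop)]
  have e : ∀ x : Fin m → ℝ, (∑ i, x i) - a = ∑ i, (x i - b) := fun x => by
    rw [Finset.sum_sub_distrib, ha]; simp
  simp_rw [e]
  rw [integral_sum_pow_three (P := Measure.pi fun _ : Fin m => ν)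
    (W := fun i (x : Fin m → ℝ) => x i - b) (by fun_prop)]
  · simp_rw [fun i : Fin m => integral_comp_eval (μ := fun _ : Fin m => ν) (i := i)
      (f := fun x : ℝ => (x - b) ^ 3) (by fun_prop)]
    simp
  · exact iIndepFun_pi (X := fun _ x => x - b) (fun _ => by fun_prop)
  · exact fun i => h3'.comp_measurePreserving (mp i)
  · intro i
    rw [integral_comp_eval (μ := fun _ : Fin m => ν) (i := i) (f := fun x : ℝ => x - b)
      (by fun_prop), integral_sub i1 (integrable_const _)]
    simp [hb]

theorem charFun_of_map_sum (hμ : (Measure.pi fun _ : Fin m => ν).map (fun x => ∑ i, x i) = μ)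
    {a b : ℝ} (hab : a = m * b) (s t : ℝ) :
    charFun (μ.map fun x => (x - a) / s) t = charFun (ν.map fun x => (x - b) / s) t ^ m := by
  have hi : iIndepFun (fun (i : Fin m) (x : Fin m → ℝ) => (x i - b) / s)
      (Measure.pi fun _ : Fin m => ν) :=
    iIndepFun_pi (X := fun _ x => (x - b) / s) (fun _ => by fun_prop)
  have hmap : ∀ i : Fin m, (Measure.pi fun _ : Fin m => ν).map (fun x => (x i - b) / s)
      = ν.map fun x => (x - b) / s := fun i => by
    conv_rhs => rw [← (measurePreserving_eval (fun _ : Fin m => ν) i).map_eq,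
      Measure.map_map (by fun_prop) (measurePreserving_eval (fun _ : Fin m => ν) i).measurable]
    rfl
  have hc := hi.charFun_map_fun_sum_eq_prod
    (fun i => Measurable.aemeasurable (by fun_prop))
  rw [← hμ, Measure.map_map (by fun_prop) (by fun_prop)]
  have e : ((fun x => (x - a) / s) ∘ fun x : Fin m → ℝ => ∑ i, x i)
      = fun x => ∑ i, (x i - b) / s := by
    ext x
    rw [← Finset.sum_div, Finset.sum_sub_distrib, hab]; simp
  rw [e, hc]
  simp [hmap]

end Root

/-- Below `b` the deviation is at most `b`, because `x ≥ 0`. This trades the absolute third moment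
for the signed one, which is additive under convolution; with `b` the mean of an `m`-th root the
price is of order `m⁻³` per summand. -/
theorem abs_pow_three_le {x b : ℝ} (hx : 0 ≤ x) (hb : 0 ≤ b) :
    |x - b| ^ 3 ≤ (x - b) ^ 3 + 2 * b ^ 3 := by
  rcases le_total b x with h | h
  · rw [abs_of_nonneg (sub_nonneg.2 h)]
    have : 0 ≤ b ^ 3 := by positivity
    linarith
  · rw [abs_of_nonpos (sub_nonpos.2 h)]
    have : (b - x) ^ 3 ≤ b ^ 3 := pow_le_pow_left₀ (sub_nonneg.2 h) (by linarith) 3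
    have e : (-(x - b)) ^ 3 = (b - x) ^ 3 := by ring
    have e2 : (x - b) ^ 3 = -(b - x) ^ 3 := by ring
    rw [e, e2]
    linarith

/-- A Lyapunov estimate for the `m` root summands: their absolute third moments add up to at most
the skewness plus `2 (mean / sd)³ / m²`. The condition on `t` keeps `1 - t²/(2m)` in the unit disc.
-/
theorem norm_charFun_standardized_sub_pow_le {m : ℕ} (hm : 0 < m) {μ ν : Measure ℝ}
    [IsProbabilityMeasure μ] [IsProbabilityMeasure ν]
    (hμ : (Measure.pi fun _ : Fin m => ν).map (fun x => ∑ i, x i) = μ)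
    (h0 : ∀ᵐ x ∂μ, 0 ≤ x) (h3 : MemLp id 3 μ) (hv : 0 < Var[id; μ]) {t : ℝ}
    (ht : t ^ 2 ≤ 2 * m) :
    ‖charFun (μ.map fun x => (x - ∫ y, y ∂μ) / √Var[id; μ]) t
        - ((1 - t ^ 2 / (2 * m) : ℝ) : ℂ) ^ m‖
      ≤ 4 * |t| ^ 3 * (skewness μ id
        + 2 * (∫ y, y ∂μ) ^ 3 / √Var[id; μ] ^ 3 * ((m : ℝ)⁻¹ ^ 2)) := by
  have n0 := ae_nonneg_of_map_sum hm hμ h0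
  have n3 := memLp_three_of_map_sum hm hμ h0 h3
  have e1 := integral_of_map_sum hμ n3
  have e2 := variance_of_map_sum hμ n3
  have e3 := integral_pow_three_of_map_sum hμ n3
  have hmR : (0 : ℝ) < m := Nat.cast_pos.2 hm
  set v := Var[id; μ] with hvdef
  set s := √v with hs
  have hs0 : 0 < s := Real.sqrt_pos.2 hv
  have hs2 : s ^ 2 = v := Real.sq_sqrt hv.le
  rw [charFun_of_map_sum hμ e1]
  have sk : skewness μ id = m * (∫ x, (x - ∫ y, y ∂ν) ^ 3 ∂ν) / s ^ 3 := by
    rw [← e3, skewness, ← integral_div]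
    refine integral_congr_ae (Eventually.of_forall fun x => ?_)
    simp only [id, ← hvdef, ← hs, div_pow]
  set b := ∫ y, y ∂ν with hb
  have hb0 : 0 ≤ b := integral_nonneg_of_ae n0
  have i1 : Integrable (fun x : ℝ => x) ν := n3.integrable (by norm_num)
  have hp : IsProbabilityMeasure (ν.map fun x => (x - b) / s) :=
    Measure.isProbabilityMeasure_map (by fun_prop)
  have m3 : MemLp (fun x : ℝ => x - b) 3 ν := n3.sub (memLp_const b)
  have c3 : Integrable (fun x : ℝ => |x - b| ^ 3) ν := by
    simpa using m3.integrable_norm_pow (p := 3) (by norm_num)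
  have d3 : Integrable (fun x : ℝ => (x - b) ^ 3) ν :=
    c3.mono' (by fun_prop) (Eventually.of_forall fun x => by simp)
  have f3 : MemLp id 3 (ν.map fun x => (x - b) / s) := by
    rw [memLp_map_measure_iff (by fun_prop) (by fun_prop)]
    simpa [div_eq_inv_mul, Function.comp_def] using m3.const_mul s⁻¹
  have f1 : ∫ x, x ∂(ν.map fun x => (x - b) / s) = 0 := by
    rw [integral_map (by fun_prop) (by fun_prop), integral_div,
      integral_sub i1 (integrable_const _)]
    simp [hb]
  have f2 : ∫ x, x ^ 2 ∂(ν.map fun x => (x - b) / s) = (m : ℝ)⁻¹ := by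
    rw [integral_map (by fun_prop) (by fun_prop)]
    simp_rw [div_pow]
    rw [integral_div, hs2]
    have : ∫ x, (x - b) ^ 2 ∂ν = Var[id; ν] := by
      rw [variance_eq_integral (by fun_prop)]
      rfl
    rw [this, e2]
    have : 0 < Var[id; ν] := by
      by_contra hc
      have := mul_nonpos_of_nonneg_of_nonpos hmR.le (not_lt.1 hc)
      linarith
    field_simp
  have f4 : ∫ x, |x| ^ 3 ∂(ν.map fun x => (x - b) / s)
      ≤ ((∫ x, (x - b) ^ 3 ∂ν) + 2 * b ^ 3) / s ^ 3 := by
    rw [integral_map (by fun_prop) (by fun_prop)]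
    simp_rw [abs_div, abs_of_pos hs0, div_pow]
    rw [integral_div]
    refine div_le_div_of_nonneg_right ?_ (by positivity)
    calc ∫ x, |x - b| ^ 3 ∂ν ≤ ∫ x, ((x - b) ^ 3 + 2 * b ^ 3) ∂ν := by
          refine integral_mono_ae c3 (d3.add (integrable_const _)) ?_
          filter_upwards [n0] with x hx using abs_pow_three_le hx hb0
      _ = _ := by
          rw [integral_add d3 (integrable_const _)]
          simp
  have k1 := norm_charFun_sub_le f3 f1 t
  rw [f2] at k1
  have e4 : 1 - t ^ 2 * (m : ℝ)⁻¹ / 2 = 1 - t ^ 2 / (2 * m) := by field_simp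
  rw [e4] at k1
  have hn1 : ‖((1 - t ^ 2 / (2 * m) : ℝ) : ℂ)‖ ≤ 1 := by
    rw [Complex.norm_real, Real.norm_eq_abs, abs_le]
    have h5 : 0 ≤ t ^ 2 / (2 * m) := by positivity
    have h6 : t ^ 2 / (2 * m) ≤ 1 := by rw [div_le_one (by positivity)]; exact ht
    constructor <;> linarith
  refine (norm_pow_sub_pow_le (norm_charFun_le_one _) hn1 m).trans ?_
  calc (m : ℝ) * _ ≤ m * (4 * |t| ^ 3 * (((∫ x, (x - b) ^ 3 ∂ν) + 2 * b ^ 3) / s ^ 3)) := by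
        gcongr
        exact k1.trans (by gcongr)
    _ = _ := by
        rw [sk, e1]
        field_simp

/-- The law of a standardized non-negative infinitely divisible variable is close to the standard
normal law if its skewness is small. -/
theorem norm_charFun_standardized_sub_le {μ : Measure ℝ} [IsProbabilityMeasure μ]
    (hdiv : InfinitelyDivisible μ) (h0 : ∀ᵐ x ∂μ, 0 ≤ x) (h3 : MemLp id 3 μ)
    (hv : 0 < Var[id; μ]) (t : ℝ) :
    ‖charFun (μ.map fun x => (x - ∫ y, y ∂μ) / √Var[id; μ]) t - Complex.exp (-(t ^ 2) / 2)‖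
      ≤ 4 * |t| ^ 3 * skewness μ id := by
  have hlim : Tendsto (fun m : ℕ => ((1 - t ^ 2 / (2 * m) : ℝ) : ℂ) ^ m) atTop
      (𝓝 (Complex.exp (-(t ^ 2) / 2))) := by
    have := Complex.tendsto_one_add_div_pow_exp (-(t ^ 2 : ℂ) / 2)
    refine this.congr fun m => ?_
    push_cast
    congr 1
    rw [div_div]
    ring
  have hlim2 : Tendsto (fun m : ℕ => 4 * |t| ^ 3 * (skewness μ id
        + 2 * (∫ y, y ∂μ) ^ 3 / √Var[id; μ] ^ 3 * ((m : ℝ)⁻¹ ^ 2))) atTop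
      (𝓝 (4 * |t| ^ 3 * (skewness μ id + 2 * (∫ y, y ∂μ) ^ 3 / √Var[id; μ] ^ 3 * 0 ^ 2))) :=
    (((tendsto_inv_atTop_nhds_zero_nat (𝕜 := ℝ)).pow 2).const_mul _).const_add _ |>.const_mul _
  -- The root depends on `m` but the left-hand law does not, so `m → ∞` leaves the skewness alone.
  have key := le_of_tendsto_of_tendsto ((tendsto_const_nhds.sub hlim).norm) hlim2 (by
    obtain ⟨M, hM⟩ := exists_nat_ge (t ^ 2)
    filter_upwards [eventually_ge_atTop (M + 1)] with m hm
    obtain ⟨ν, hν, hμ⟩ := hdiv m (by omega)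
    refine norm_charFun_standardized_sub_pow_le (by omega) hμ h0 h3 hv ?_
    have : ((M : ℝ) + 1) ≤ m := by exact_mod_cast hm
    have : (0 : ℝ) ≤ M := Nat.cast_nonneg M
    linarith)
  simpa using key

/-! ### Asymptotic normality of the standardized claims. -/

section CentralLimit

variable {ι : Type*} {l : Filter ι} [l.IsCountablyGenerated] {Ω : ι → Type*}
  [∀ τ, MeasurableSpace (Ω τ)] {P : (τ : ι) → Measure (Ω τ)} [∀ τ, IsProbabilityMeasure (P τ)]

/-- Dividing by `d` instead of the standard deviation only rescales `t`; the case of interest is `d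
= ω E Y`. -/
theorem norm_charFun_map_standardized_sub_le {Ω : Type*} [MeasurableSpace Ω] {P : Measure Ω}
    [IsProbabilityMeasure P] {Y : Ω → ℝ} (hm : Measurable Y) (h0 : ∀ᵐ w ∂P, 0 ≤ Y w)
    (hdiv : InfinitelyDivisible (P.map Y)) (h3 : MemLp Y 3 P) (hv : 0 < Var[Y; P]) (d t : ℝ) :
    ‖charFun (P.map fun w => (Y w - ∫ w', Y w' ∂P) / d) t
        - Complex.exp (-(((√Var[Y; P] / d * t) ^ 2 : ℝ) : ℂ) / 2)‖
      ≤ 4 * |√Var[Y; P] / d * t| ^ 3 * skewness P Y := by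
  have hp : IsProbabilityMeasure (P.map Y) := Measure.isProbabilityMeasure_map hm.aemeasurable
  have e1 : ∫ y, y ∂(P.map Y) = ∫ w, Y w ∂P := integral_map hm.aemeasurable (by fun_prop)
  have e2 : Var[id; P.map Y] = Var[Y; P] := by
    rw [variance_map (by fun_prop) hm.aemeasurable]; rfl
  have e3 : skewness (P.map Y) id = skewness P Y := by
    rw [skewness, skewness, integral_map hm.aemeasurable (by fun_prop)]
    simp only [id, e1]
    rw [← e2]
  have h0' : ∀ᵐ x ∂(P.map Y), 0 ≤ x :=
    (ae_map_iff hm.aemeasurable measurableSet_Ici).2 h0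
  have key := norm_charFun_standardized_sub_le hdiv h0'
    ((memLp_map_measure_iff (by fun_prop) hm.aemeasurable).2 h3) (by rwa [e2])
    (√Var[Y; P] / d * t)
  rw [e1, e2, e3, ← charFun_map_mul, Measure.map_map (by fun_prop) (by fun_prop),
    Measure.map_map (by fun_prop) hm] at key
  have hs : √Var[Y; P] ≠ 0 := (Real.sqrt_pos.2 hv).ne'
  have e4 : (((fun x => √Var[Y; P] / d * x) ∘ fun x => (x - ∫ w, Y w ∂P) / √Var[Y; P]) ∘ Y)
      = fun w => (Y w - ∫ w', Y w' ∂P) / d := by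
    ext w
    simp only [Function.comp_apply]
    field_simp
  rw [e4] at key
  refine le_trans (le_of_eq ?_) key
  push_cast
  rfl

theorem tendsto_standardized_gaussianReal {Y : (τ : ι) → Ω τ → ℝ} {ω : ι → ℝ}
    (hm : ∀ τ, Measurable (Y τ)) (h0 : ∀ τ, ∀ᵐ w ∂(P τ), 0 ≤ Y τ w)
    (hdiv : ∀ τ, InfinitelyDivisible ((P τ).map (Y τ))) (h3 : ∀ τ, MemLp (Y τ) 3 (P τ))
    (hsk : Tendsto (fun τ => skewness (P τ) (Y τ)) l (𝓝 0)) (hω : ∀ τ, 0 < ω τ)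
    (hpos : ∀ τ, 0 < ∫ w, Y τ w ∂(P τ))
    (hvar : Tendsto (fun τ => Var[Y τ; P τ] / (ω τ ^ 2 * (∫ w, Y τ w ∂(P τ)) ^ 2)) l (𝓝 1)) :
    TendstoInDistribution (fun τ w => (Y τ w - ∫ w', Y τ w' ∂(P τ)) / (ω τ * ∫ w', Y τ w' ∂(P τ)))
      l id P (gaussianReal 0 1) where
  forall_aemeasurable τ := by have := hm τ; fun_prop
  aemeasurable_limit := aemeasurable_id
  tendsto := by
    -- Lévy's continuity theorem is used along sequences, which is enough because `l` is countably
    -- generated.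
    refine tendsto_of_seq_tendsto fun u hu => ?_
    refine ProbabilityMeasure.tendsto_of_tendsto_charFun fun t => ?_
    simp only [ProbabilityMeasure.coe_mk, Measure.map_id]
    have hr : Tendsto (fun τ => √Var[Y τ; P τ] / (ω τ * ∫ w', Y τ w' ∂(P τ)) * t) l (𝓝 (1 * t)) := by
      refine Tendsto.mul_const _ ?_
      have := (Real.continuous_sqrt.tendsto _).comp hvar
      rw [Real.sqrt_one] at this
      refine this.congr fun τ => ?_
      rw [Function.comp_apply, ← mul_pow, Real.sqrt_div' _ (sq_nonneg _),
        Real.sqrt_sq (mul_pos (hω τ) (hpos τ)).le]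
    rw [one_mul] at hr
    -- A variance ratio tending to `1` rules out degenerate claims near the limit.
    have hv : ∀ᶠ τ in l, 0 < Var[Y τ; P τ] := by
      filter_upwards [hvar.eventually (lt_mem_nhds one_pos)] with τ hτ
      by_contra hc
      have : Var[Y τ; P τ] = 0 := le_antisymm (not_lt.1 hc) (variance_nonneg _ _)
      rw [this, zero_div] at hτ
      exact hτ.false
    have hb : Tendsto (fun τ => 4 * |√Var[Y τ; P τ] / (ω τ * ∫ w', Y τ w' ∂(P τ)) * t| ^ 3
        * skewness (P τ) (Y τ)) l (𝓝 0) := by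
      simpa using ((hr.abs.pow 3).const_mul 4).mul hsk
    have he : Tendsto (fun τ => Complex.exp
        (-(((√Var[Y τ; P τ] / (ω τ * ∫ w', Y τ w' ∂(P τ)) * t) ^ 2 : ℝ) : ℂ) / 2)) l
        (𝓝 (Complex.exp (-((t ^ 2 : ℝ) : ℂ) / 2))) :=
      ((by fun_prop : Continuous fun r : ℝ => Complex.exp (-((r ^ 2 : ℝ) : ℂ) / 2)).tendsto t).comp
        hr
    have hd := squeeze_zero_norm' (by
      filter_upwards [hv] with τ hτ using
        norm_charFun_map_standardized_sub_le (hm τ) (h0 τ) (hdiv τ) (h3 τ) hτ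
          (ω τ * ∫ w', Y τ w' ∂(P τ)) t) hb
    have := (hd.add he).comp hu
    rw [charFun_gaussianReal]
    refine (this.congr fun n => ?_).trans (le_of_eq ?_)
    · simp only [Function.comp_apply, sub_add_cancel]
      rfl
    · congr 2
      push_cast
      simp
      ring_nf

/-- The standardized claims of a generalized log-normal array are asymptotically jointly standard
normal. -/
theorem GeneralizedLogNormal.tendstoInDistribution_standardized {p k : ℕ} {S : Finset (ℕ × ℕ)}
    {X : ℕ × ℕ → Fin p → ℝ} {ξ : Fin p → ℝ} {ω : ι → ℝ} {Y : (τ : ι) → ℕ × ℕ → Ω τ → ℝ}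
    (hY : GeneralizedLogNormal k S X ξ ω l P Y) :
    TendstoInDistribution
      (fun τ w => (ω τ, fun c : S => (Y τ c w - ∫ w', Y τ c w' ∂(P τ))
        / (ω τ * ∫ w', Y τ c w' ∂(P τ))))
      l (fun z => ((0 : ℝ), z)) P (Measure.pi fun _ : S => gaussianReal 0 1) := by
  have h1 := fun c : S => tendsto_standardized_gaussianReal (P := P) (l := l)
    (Y := fun τ => Y τ c) (ω := ω) (fun τ => hY.measurable τ c c.2)
    (fun τ => hY.nonneg τ c c.2) (fun τ => hY.infinitelyDivisible τ c c.2)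
    (fun τ => hY.third_moment τ c c.2) (hY.skewness_tendsto c c.2) hY.omega_pos
    (fun τ => hY.mean_pos τ c c.2) (hY.variance_ratio c c.2)
  have hm : ∀ τ, ∀ c : S, Measurable (Y τ c) := fun τ c => hY.measurable τ c c.2
  have hω : Tendsto ω l (𝓝 0) := by
    have := (Real.continuous_sqrt.tendsto _).comp hY.omega_tendsto
    rw [Real.sqrt_zero] at this
    exact this.congr fun τ => Real.sqrt_sq (hY.omega_pos τ).le
  have ham : ∀ τ, AEMeasurable (fun w => (ω τ, fun c : S => (Y τ c w - ∫ w', Y τ c w' ∂(P τ))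
      / (ω τ * ∫ w', Y τ c w' ∂(P τ)))) (P τ) := fun τ => by
    have := hm τ
    fun_prop
  refine ⟨ham, by fun_prop, ?_⟩
  -- By independence the joint law is a product measure, and products depend continuously on their
  -- factors. The number `ω` enters as a Dirac mass, so that continuous mapping can use one fixed
  -- function of `(ω, z)`.
  have h2 := (ProbabilityMeasure.continuous_pi.tendsto _).comp
    (tendsto_pi_nhds.2 fun c : S => (h1 c).tendsto)
  have h3 := (ProbabilityMeasure.continuous_prod.tendsto _).comp
    (((continuous_diracProba.tendsto (0 : ℝ)).comp hω).prodMk_nhds h2)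
  refine (h3.congr fun τ => ?_).trans (le_of_eq ?_)
  · symm
    apply Subtype.ext
    have hi := (hY.independent τ).comp (fun c x => (x - ∫ w', Y τ c w' ∂(P τ))
        / (ω τ * ∫ w', Y τ c w' ∂(P τ))) (fun c => by fun_prop)
    have := (iIndepFun_iff_map_fun_eq_pi_map (fun c => (by have := hm τ; fun_prop))).1 hi
    have e : (fun w => (ω τ, fun c : S => (Y τ c w - ∫ w', Y τ c w' ∂(P τ))
      / (ω τ * ∫ w', Y τ c w' ∂(P τ)))) = Prod.mk (ω τ) ∘ fun w => fun c : S =>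
        (Y τ c w - ∫ w', Y τ c w' ∂(P τ)) / (ω τ * ∫ w', Y τ c w' ∂(P τ)) := rfl
    simp only [e]
    rw [← Measure.map_map (by fun_prop) (by have := hm τ; fun_prop)]
    change _ = (Measure.dirac (ω τ)).prod (Measure.pi fun c : S => (P τ).map
      ((fun x => (x - ∫ w', Y τ c w' ∂(P τ)) / (ω τ * ∫ w', Y τ c w' ∂(P τ))) ∘ Y τ c))
    rw [← this, Measure.dirac_prod]
    rfl
  · congr 1
    symm
    apply Subtype.ext
    change _ = (Measure.dirac (0 : ℝ)).prod (Measure.pi fun _ : S => (gaussianReal 0 1).map id)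
    simp only [Measure.map_id]
    rw [Measure.dirac_prod]

end CentralLimit

/-! ### Equivariance and continuity of least squares. -/

section LeastSquares

variable {p k : ℕ} {X : ℕ × ℕ → Fin p → ℝ}

theorem Identified.isUnit_det (hX : Identified k X) :
    IsUnit ((designMatrix k X)ᵀ * designMatrix k X).det := by
  have h := (Matrix.PosDef.conjTranspose_mul_self _ ((identified_iff k X).1 hX)).isUnit
  rw [Matrix.conjTranspose_eq_transpose_of_trivial] at h
  exact (Matrix.isUnit_iff_isUnit_det _).1 h

theorem predictor_eq_mulVec (ξ : Fin p → ℝ) (c : upperTriangle k) :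
    predictor X ξ c = (designMatrix k X *ᵥ ξ) c := rfl

theorem predictor_add_smul (ξ η : Fin p → ℝ) (t : ℝ) (c : ℕ × ℕ) :
    predictor X (ξ + t • η) c = predictor X ξ c + t * predictor X η c := by
  simp [predictor, dotProduct_add, dotProduct_smul]

theorem Identified.olsEstimator_add_smul (hX : Identified k X) (ξ : Fin p → ℝ) (t : ℝ)
    (e : upperTriangle k → ℝ) :
    olsEstimator k X (fun c => predictor X ξ c + t * e c) = ξ + t • olsEstimator k X e := by
  have h : (fun c : upperTriangle k => predictor X ξ c + t * e c)
      = designMatrix k X *ᵥ ξ + t • e := rfl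
  simp only [olsEstimator]
  rw [h, Matrix.mulVec_add, Matrix.mulVec_add, Matrix.mulVec_smul, Matrix.mulVec_smul,
    Matrix.mulVec_mulVec, Matrix.mulVec_mulVec, Matrix.mul_assoc,
    Matrix.nonsing_inv_mul _ hX.isUnit_det, Matrix.one_mulVec]

theorem Identified.sSq_add_smul (hX : Identified k X) (ξ : Fin p → ℝ) (t : ℝ)
    (e : upperTriangle k → ℝ) :
    sSq k X (fun c => predictor X ξ c + t * e c) = t ^ 2 * sSq k X e := by
  simp only [sSq, rss]
  rw [hX.olsEstimator_add_smul, mul_div_assoc', Finset.mul_sum]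
  congr 1
  refine Finset.sum_congr rfl fun c _ => ?_
  rw [predictor_add_smul]
  ring

@[fun_prop]
theorem continuous_olsEstimator : Continuous (olsEstimator k X) := by
  unfold olsEstimator
  fun_prop

@[fun_prop]
theorem continuous_predictor (c : ℕ × ℕ) : Continuous fun ξ => predictor X ξ c := by
  unfold predictor
  fun_prop

@[fun_prop]
theorem continuous_sSq : Continuous (sSq k X) := by
  unfold sSq rss
  refine Continuous.div_const (continuous_finsetSum _ fun c _ => ?_) _
  exact ((continuous_apply c).sub
    ((continuous_predictor (c : ℕ × ℕ)).comp continuous_olsEstimator)).pow 2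

theorem continuous_pointForecast (A : Finset (ℕ × ℕ)) : Continuous (pointForecast k X A) := by
  unfold pointForecast
  refine continuous_finsetSum _ fun c _ => Real.continuous_exp.comp ?_
  exact ((continuous_predictor c).comp continuous_olsEstimator).add (continuous_sSq.div_const 2)

theorem continuous_processVar (A : Finset (ℕ × ℕ)) : Continuous (processVar X A) := by
  unfold processVar
  exact continuous_finsetSum _ fun c _ =>
    Real.continuous_exp.comp ((continuous_predictor c).const_mul 2)

theorem continuous_estimationVar (A : Finset (ℕ × ℕ)) : Continuous (estimationVar k X A) := by
  have h : Continuous fun ξ => ∑ c ∈ A, Real.exp (predictor X ξ c) • X c :=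
    continuous_finsetSum _ fun c _ =>
      (Real.continuous_exp.comp (continuous_predictor c)).smul continuous_const
  unfold estimationVar
  fun_prop

end LeastSquares

/-! ### Expansion of the studentized forecast error -/

section Expansion

variable {p : ℕ} (k : ℕ) (X : ℕ × ℕ → Fin p → ℝ)

/-- The claims `exp (X_{ij}' ξ + t² / 2) (1 + t z_{ij})`. -/
noncomputable def scaledClaims (ξ : Fin p → ℝ) (t : ℝ) (z : ℕ × ℕ → ℝ) (c : ℕ × ℕ) : ℝ :=
  Real.exp (predictor X ξ c + t ^ 2 / 2) * (1 + t * z c)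

/-- The logarithms of the claims of the upper triangle. -/
noncomputable def logUpper (y : ℕ × ℕ → ℝ) : upperTriangle k → ℝ := fun c => Real.log (y c)

/-- The regression errors, in units of `t`, of the logarithms of `scaledClaims`, in a form which
makes sense for `t = 0`. -/
noncomputable def scaledErrors (t : ℝ) (z : ℕ × ℕ → ℝ) : upperTriangle k → ℝ := fun c =>
  t / 2 + dslope (fun x => Real.log (1 + x)) 0 (t * z c) * z c

/-- The studentized forecast error, as a function of the claims. -/
noncomputable def studentizedError (A : Finset (ℕ × ℕ)) (y : ℕ × ℕ → ℝ) : ℝ :=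
  (√(sSq k X (logUpper k y)))⁻¹ * (∑ c ∈ A, y c - pointForecast k X A (logUpper k y))

/-- The studentized forecast error of `scaledClaims`, in a form which makes sense for `t = 0`. -/
noncomputable def studentizedExpansion (ξ : Fin p → ℝ) (A : Finset (ℕ × ℕ)) (t : ℝ)
    (z : ℕ × ℕ → ℝ) : ℝ :=
  (√(sSq k X (scaledErrors k t z)))⁻¹ * ∑ c ∈ A, Real.exp (predictor X ξ c) *
    (Real.exp (t ^ 2 / 2) * z c + dslope Real.exp 0 (t ^ 2 / 2) * (t / 2)
      - dslope Real.exp 0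
          (t * (predictor X (olsEstimator k X (scaledErrors k t z)) c
            + t * sSq k X (scaledErrors k t z) / 2))
        * (predictor X (olsEstimator k X (scaledErrors k t z)) c
            + t * sSq k X (scaledErrors k t z) / 2))

variable {k X}

/-- Valid at `0` too, so an exponential increment can lose its factor `t` without a division. -/
theorem dslope_exp_mul (x : ℝ) : dslope Real.exp 0 x * x = Real.exp x - 1 := by
  have := sub_smul_dslope Real.exp 0 x
  rw [sub_zero, smul_eq_mul, Real.exp_zero] at this
  rw [mul_comm, this]

theorem dslope_log_one_add_mul (x : ℝ) :
    dslope (fun x => Real.log (1 + x)) 0 x * x = Real.log (1 + x) := by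
  have := sub_smul_dslope (fun x => Real.log (1 + x)) 0 x
  rw [sub_zero, smul_eq_mul, add_zero, Real.log_one, sub_zero] at this
  rw [mul_comm, this]

theorem logUpper_scaledClaims (ξ : Fin p → ℝ) {t : ℝ} {z : ℕ × ℕ → ℝ}
    (hz : ∀ c ∈ upperTriangle k, 0 < 1 + t * z c) :
    logUpper k (scaledClaims X ξ t z)
      = fun c : upperTriangle k => predictor X ξ c + t * scaledErrors k t z c := by
  funext c
  rw [logUpper, scaledClaims, Real.log_mul (Real.exp_pos _).ne' (hz c c.2).ne', Real.log_exp,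
    ← dslope_log_one_add_mul, scaledErrors]
  ring

theorem Identified.studentizedError_scaledClaims (hX : Identified k X) (ξ : Fin p → ℝ)
    (A : Finset (ℕ × ℕ)) {t : ℝ} (ht : 0 < t) {z : ℕ × ℕ → ℝ}
    (hz : ∀ c ∈ upperTriangle k, 0 < 1 + t * z c) :
    studentizedError k X A (scaledClaims X ξ t z) = studentizedExpansion k X ξ A t z := by
  rw [studentizedError, studentizedExpansion, pointForecast, logUpper_scaledClaims ξ hz,
    hX.sSq_add_smul, hX.olsEstimator_add_smul]
  set e := scaledErrors k t z
  set s := sSq k X e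
  rw [Real.sqrt_mul (sq_nonneg t), Real.sqrt_sq ht.le, mul_inv, mul_comm t⁻¹, mul_assoc,
    ← Finset.sum_sub_distrib, Finset.mul_sum]
  congr 1
  refine Finset.sum_congr rfl fun c _ => ?_
  rw [predictor_add_smul, scaledClaims]
  set h := predictor X (olsEstimator k X e) c
  have e1 := dslope_exp_mul (t ^ 2 / 2)
  have e2 := dslope_exp_mul (t * (h + t * s / 2))
  have e3 : Real.exp (predictor X ξ c + t * h + t ^ 2 * s / 2)
      = Real.exp (predictor X ξ c) * Real.exp (t * (h + t * s / 2)) := by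
    rw [← Real.exp_add]; congr 1; ring
  rw [Real.exp_add, e3]
  rw [inv_mul_eq_iff_eq_mul₀ ht.ne']
  -- Apart from the common factor, `exp (t²/2) (1 + t z)` minus the forecast is `t exp (t²/2) z`
  -- plus a difference of two increments `exp - 1`, supplied by `e1` and `e2`.
  linear_combination (-Real.exp (predictor X ξ c)) * e1 + Real.exp (predictor X ξ c) * e2

theorem scaledErrors_zero (z : ℕ × ℕ → ℝ) : scaledErrors k 0 z = fun c : upperTriangle k => z c := by
  funext c
  have h : HasDerivAt (fun x : ℝ => Real.log (1 + x)) 1 0 := by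
    have := (((hasDerivAt_id (0 : ℝ)).const_add 1).log (by simp))
    simpa using this
  simp [scaledErrors, h.deriv]

/-- The log-normal mean corrections `t²/2` and `t² s²/2` are of second order and disappear, while
all slopes become `1`. -/
theorem studentizedExpansion_zero (ξ : Fin p → ℝ) (A : Finset (ℕ × ℕ)) (z : ℕ × ℕ → ℝ) :
    studentizedExpansion k X ξ A 0 z
      = (√(sSq k X fun c => z c))⁻¹ * ∑ c ∈ A, Real.exp (predictor X ξ c)
        * (z c - predictor X (olsEstimator k X fun c => z c) c) := by
  simp [studentizedExpansion, scaledErrors_zero]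

theorem continuousAt_dslope_exp : ContinuousAt (dslope Real.exp 0) 0 :=
  continuousAt_dslope_same.2 Real.differentiableAt_exp

theorem continuousAt_dslope_log_one_add :
    ContinuousAt (dslope (fun x => Real.log (1 + x)) 0) 0 :=
  continuousAt_dslope_same.2 (((differentiableAt_const 1).add differentiableAt_id).log (by simp))

theorem continuousAt_scaledErrors (z : ℕ × ℕ → ℝ) :
    ContinuousAt (fun x : ℝ × (ℕ × ℕ → ℝ) => scaledErrors k x.1 x.2) (0, z) := by
  refine continuousAt_pi.2 fun c => ?_
  refine ContinuousAt.add (by fun_prop) (ContinuousAt.mul ?_ (by fun_prop))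
  exact ContinuousAt.comp_of_eq (f := fun x : ℝ × (ℕ × ℕ → ℝ) => x.1 * x.2 c)
    continuousAt_dslope_log_one_add (by fun_prop) (by simp)

/-- Differentiability of `exp` and `log` makes the slopes continuous at `0`; only the inverse of `s`
needs a condition. -/
theorem continuousAt_studentizedExpansion (ξ : Fin p → ℝ) (A : Finset (ℕ × ℕ)) {z : ℕ × ℕ → ℝ}
    (hz : 0 < sSq k X fun c => z c) :
    ContinuousAt (fun x : ℝ × (ℕ × ℕ → ℝ) => studentizedExpansion k X ξ A x.1 x.2) (0, z) := by
  have he := continuousAt_scaledErrors (k := k) z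
  have hs : ContinuousAt (fun x : ℝ × (ℕ × ℕ → ℝ) => sSq k X (scaledErrors k x.1 x.2)) (0, z) :=
    continuous_sSq.continuousAt.comp he
  have ho : ContinuousAt (fun x : ℝ × (ℕ × ℕ → ℝ) =>
      olsEstimator k X (scaledErrors k x.1 x.2)) (0, z) :=
    continuous_olsEstimator.continuousAt.comp he
  refine ContinuousAt.mul (ContinuousAt.inv₀ (Real.continuous_sqrt.continuousAt.comp hs) ?_) ?_
  · simp only [scaledErrors_zero]
    exact (Real.sqrt_pos.2 hz).ne'
  · refine tendsto_finsetSum _ fun c _ => ContinuousAt.mul (by fun_prop) ?_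
    have hb : ContinuousAt (fun x : ℝ × (ℕ × ℕ → ℝ) =>
        predictor X (olsEstimator k X (scaledErrors k x.1 x.2)) c
          + x.1 * sSq k X (scaledErrors k x.1 x.2) / 2) (0, z) :=
      ((continuous_predictor c).continuousAt.comp ho).add ((continuousAt_fst.mul hs).div_const 2)
    refine ContinuousAt.sub (ContinuousAt.add (by fun_prop) (ContinuousAt.mul ?_ (by fun_prop)))
      (ContinuousAt.mul ?_ hb)
    · exact ContinuousAt.comp_of_eq (f := fun x : ℝ × (ℕ × ℕ → ℝ) => x.1 ^ 2 / 2)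
        continuousAt_dslope_exp (by fun_prop) (by simp)
    · exact ContinuousAt.comp_of_eq (f := fun x : ℝ × (ℕ × ℕ → ℝ) =>
        x.1 * (predictor X (olsEstimator k X (scaledErrors k x.1 x.2)) c
          + x.1 * sSq k X (scaledErrors k x.1 x.2) / 2))
        continuousAt_dslope_exp (continuousAt_fst.mul hb) (by simp)

end Expansion

/-! ### Linear functions of standard normal vectors -/

/-- The coordinates of a standard normal vector along an orthonormal family are independent
standard normal variables. -/
theorem map_pi_gaussianReal_of_orthonormal {κ S : Type*} [Fintype κ] [Fintype S]
    {v : κ → S → ℝ} (hv : Orthonormal ℝ fun i => WithLp.toLp 2 (v i)) :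
    (Measure.pi fun _ : S => gaussianReal 0 1).map (fun u i => ∑ c, v i c * u c)
      = Measure.pi fun _ : κ => gaussianReal 0 1 := by
  have key : ((Measure.pi fun _ : S => gaussianReal 0 1).map (fun u i => ∑ c, v i c * u c)).map
      (MeasurableEquiv.toLp 2 (κ → ℝ)) = (Measure.pi fun _ : κ => gaussianReal 0 1).map
      (MeasurableEquiv.toLp 2 (κ → ℝ)) := by
    have hm : Measurable fun (u : S → ℝ) (i : κ) => ∑ c, v i c * u c := by fun_prop
    have e1 : (MeasurableEquiv.toLp 2 (κ → ℝ)) ∘ (fun (u : S → ℝ) (i : κ) => ∑ c, v i c * u c)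
        = (fun x : EuclideanSpace ℝ S => WithLp.toLp 2 fun i => ∑ c, v i c * x c)
          ∘ WithLp.toLp 2 := rfl
    have hL : Measurable
        (fun x : EuclideanSpace ℝ S => WithLp.toLp 2 fun i : κ => ∑ c, v i c * x c) := by
      fun_prop
    rw [Measure.map_map (by fun_prop) hm, e1, ← Measure.map_map hL (by fun_prop),
      map_pi_eq_stdGaussian]
    change _ = (Measure.pi fun _ : κ => gaussianReal 0 1).map (WithLp.toLp 2)
    rw [map_pi_eq_stdGaussian]
    apply Measure.ext_of_charFun
    ext t
    have e2 : ∀ x : EuclideanSpace ℝ S,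
        inner ℝ (WithLp.toLp 2 fun i : κ => ∑ c, v i c * x c) t
          = inner ℝ x (∑ i, t i • WithLp.toLp 2 (v i)) := fun x => by
      simp only [PiLp.inner_apply, inner_sum, inner_smul_right, RCLike.inner_apply, conj_trivial]
    -- The standard Gaussian characteristic function depends only on the norm, which an orthonormal
    -- family preserves.
    have e3 : ‖∑ i, t i • WithLp.toLp 2 (v i)‖ ^ 2 = ‖t‖ ^ 2 := by
      rw [← real_inner_self_eq_norm_sq, hv.inner_sum, EuclideanSpace.real_norm_sq_eq]
      simp [sq]
    rw [charFun_apply, integral_map hL.aemeasurable (by fun_prop)]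
    simp_rw [e2]
    rw [← charFun_apply, charFun_stdGaussian, charFun_stdGaussian, ← Complex.ofReal_pow, e3,
      Complex.ofReal_pow]
  exact (MeasurableEquiv.toLp 2 (κ → ℝ)).map_measurableEquiv_injective key

theorem map_pi_gaussianReal_studentT (ν : ℕ) :
    (Measure.pi fun _ : Fin (ν + 1) => gaussianReal 0 1).map
        (fun x => x 0 / √((∑ i : Fin ν, x i.succ ^ 2) / ν)) = studentT ν := by
  have hq : Measurable fun z : Fin ν → ℝ => ∑ i, z i ^ 2 := by fun_prop
  have e1 : (gaussianReal 0 1).prod (chiSquared ν)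
      = ((gaussianReal 0 1).prod (Measure.pi fun _ : Fin ν => gaussianReal 0 1)).map
        (Prod.map id fun z => ∑ i, z i ^ 2) := by
    rw [chiSquared, ← Measure.map_prod_map _ _ measurable_id hq, Measure.map_id]
  have e2 := (measurePreserving_piFinSuccAbove (fun _ : Fin (ν + 1) => gaussianReal 0 1) 0)
  rw [studentT, e1, ← e2.map_eq, Measure.map_map (by fun_prop) (by fun_prop),
    Measure.map_map (by fun_prop) e2.measurable]
  rfl

/-- Together `v` and the `b i` are orthonormal, so numerator and denominator use distinct
independent coordinates. -/
theorem map_studentized_of_orthonormal {S : Type*} [Fintype S] {ν : ℕ} {v : S → ℝ}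
    {b : Fin ν → S → ℝ} (hv : ‖WithLp.toLp 2 v‖ = 1)
    (hb : Orthonormal ℝ fun i => WithLp.toLp 2 (b i)) (hvb : ∀ i, ∑ c, v c * b i c = 0) :
    (Measure.pi fun _ : S => gaussianReal 0 1).map
        (fun u => (∑ c, v c * u c) / √((∑ i, (∑ c, b i c * u c) ^ 2) / ν)) = studentT ν := by
  have h : Orthonormal ℝ fun i => WithLp.toLp 2 ((Fin.cons v b : Fin (ν + 1) → S → ℝ) i) := by
    have e : (fun i => WithLp.toLp 2 ((Fin.cons v b : Fin (ν + 1) → S → ℝ) i))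
        = Matrix.vecCons (WithLp.toLp 2 v) fun i => WithLp.toLp 2 (b i) := by
      funext i
      cases i using Fin.cases <;> rfl
    rw [e, orthonormal_vecCons_iff]
    refine ⟨hv, fun i => ?_, hb⟩
    rw [← hvb i]
    simp [PiLp.inner_apply, mul_comm]
  rw [← map_pi_gaussianReal_studentT, ← map_pi_gaussianReal_of_orthonormal h,
    Measure.map_map (by fun_prop) (by fun_prop)]
  rfl

theorem ae_sum_sq_pos_of_orthonormal {S : Type*} [Fintype S] {ν : ℕ} (hν : 0 < ν)
    {b : Fin ν → S → ℝ} (hb : Orthonormal ℝ fun i => WithLp.toLp 2 (b i)) :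
    ∀ᵐ u ∂(Measure.pi fun _ : S => gaussianReal 0 1), 0 < ∑ i, (∑ c, b i c * u c) ^ 2 := by
  have hm : Measurable fun (u : S → ℝ) (i : Fin ν) => ∑ c, b i c * u c := by fun_prop
  have h1 : ∀ᵐ x ∂(Measure.pi fun _ : Fin ν => gaussianReal 0 1), x ⟨0, hν⟩ ≠ 0 := by
    refine (measurePreserving_eval (fun _ : Fin ν => gaussianReal 0 1)
      ⟨0, hν⟩).quasiMeasurePreserving.ae (p := fun y => y ≠ 0) ?_
    have : NullSingletonClass (gaussianReal 0 1) := nullSingletonClass_gaussianReal one_ne_zero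
    simp [ae_iff]
  rw [← map_pi_gaussianReal_of_orthonormal hb] at h1
  filter_upwards [ae_of_ae_map hm.aemeasurable h1] with u hu
  exact Finset.sum_pos' (fun i _ => sq_nonneg _) ⟨⟨0, hν⟩, Finset.mem_univ _, by positivity⟩

/-! ### The limit law -/

section LimitLaw

variable {p k : ℕ} {X : ℕ × ℕ → Fin p → ℝ}

/-- The cells of both triangles. -/
abbrev allCells (k : ℕ) : Finset (ℕ × ℕ) := upperTriangle k ∪ lowerTriangle k

theorem disjoint_upperTriangle_lowerTriangle (k : ℕ) :
    Disjoint (upperTriangle k) (lowerTriangle k) := by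
  rw [Finset.disjoint_left]
  intro c h1 h2
  simp only [upperTriangle, lowerTriangle, Finset.mem_filter] at h1 h2
  omega

theorem Identified.transpose_mulVec_residual (hX : Identified k X) (y : upperTriangle k → ℝ) :
    (designMatrix k X)ᵀ *ᵥ (y - designMatrix k X *ᵥ olsEstimator k X y) = 0 := by
  rw [Matrix.mulVec_sub, olsEstimator, Matrix.mulVec_mulVec, Matrix.mulVec_mulVec,
    Matrix.mul_nonsing_inv _ hX.isUnit_det, Matrix.one_mulVec, sub_self]

/-- The residual sum of squares is the sum of the squared coordinates along an orthonormal basis of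
the orthogonal complement of the column space of the design matrix. -/
theorem Identified.exists_orthonormal_rss (hX : Identified k X) :
    ∃ b : Fin (numObs k - p) → EuclideanSpace ℝ (upperTriangle k), Orthonormal ℝ b ∧
      (∀ i η, ∑ c, b i c * predictor X η c = 0) ∧
      ∀ y, rss k X y = ∑ i, (∑ c, b i c * y c) ^ 2 := by
  let f : (Fin p → ℝ) →ₗ[ℝ] EuclideanSpace ℝ (upperTriangle k) :=
    (WithLp.linearEquiv 2 ℝ (upperTriangle k → ℝ)).symm.toLinearMap ∘ₗ (designMatrix k X).mulVecLin
  have hf : ∀ η, f η = WithLp.toLp 2 (designMatrix k X *ᵥ η) := fun _ => rfl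
  have hinj : Function.Injective f := fun a b h => by
    rw [hf, hf] at h
    exact (identified_iff k X).1 hX (WithLp.toLp_injective 2 h)
  set V := LinearMap.range f
  have hdim : Module.finrank ℝ Vᗮ = numObs k - p := by
    have h1 := V.finrank_add_finrank_orthogonal
    rw [LinearMap.finrank_range_of_inj hinj] at h1
    simp only [Module.finrank_fintype_fun_eq_card, Fintype.card_fin, finrank_euclideanSpace,
      Fintype.card_coe, card_upperTriangle] at h1
    omega
  let B := (stdOrthonormalBasis ℝ Vᗮ).reindex (finCongr hdim)
  have hB : ∀ i η, ∑ c, (B i : EuclideanSpace ℝ (upperTriangle k)) c * predictor X η c = 0 := by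
    intro i η
    have := (Submodule.mem_orthogonal V _).1 (B i).2 (f η) ⟨η, rfl⟩
    simpa [PiLp.inner_apply, hf, predictor_eq_mulVec] using this
  refine ⟨fun i => B i, B.orthonormal.comp_linearIsometry Vᗮ.subtypeₗᵢ, hB, fun y => ?_⟩
  let r : EuclideanSpace ℝ (upperTriangle k) :=
    WithLp.toLp 2 (y - designMatrix k X *ᵥ olsEstimator k X y)
  -- By the normal equations the residual lies in the complement, where Parseval computes its norm;
  -- the fitted part then drops out of each coordinate.
  have hr : r ∈ Vᗮ := by
    rw [Submodule.mem_orthogonal]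
    rintro _ ⟨η, rfl⟩
    have h1 : inner ℝ (f η) r
        = (designMatrix k X *ᵥ η) ⬝ᵥ (y - designMatrix k X *ᵥ olsEstimator k X y) := by
      simp [PiLp.inner_apply, hf, r, dotProduct, mul_comm]
    rw [h1, dotProduct_comm, Matrix.dotProduct_mulVec, ← Matrix.mulVec_transpose,
      hX.transpose_mulVec_residual, zero_dotProduct]
  have h2 := B.sum_sq_norm_inner_right ⟨r, hr⟩
  have h3 : ‖(⟨r, hr⟩ : Vᗮ)‖ ^ 2 = rss k X y := by
    rw [Submodule.coe_norm, EuclideanSpace.real_norm_sq_eq]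
    rfl
  rw [← h3, ← h2]
  refine Finset.sum_congr rfl fun i _ => ?_
  rw [Real.norm_eq_abs, sq_abs, Submodule.coe_inner]
  congr 1
  have h4 : inner ℝ (B i : EuclideanSpace ℝ (upperTriangle k)) r
      = ∑ c, (B i : EuclideanSpace ℝ (upperTriangle k)) c
        * (y c - predictor X (olsEstimator k X y) c) := by
    simp only [PiLp.inner_apply, RCLike.inner_apply, conj_trivial]
    exact Finset.sum_congr rfl fun c _ => mul_comm _ _
  rw [h4]
  simp_rw [mul_sub]
  rw [Finset.sum_sub_distrib, hB, sub_zero]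

variable (k X) in
/-- The vector `(X'X)⁻¹ {∑_𝓐 exp (X_{ij}' ξ) X_{ij}}`. -/
noncomputable def forecastGradient (A : Finset (ℕ × ℕ)) (ξ : Fin p → ℝ) : Fin p → ℝ :=
  ((designMatrix k X)ᵀ * designMatrix k X)⁻¹ *ᵥ ∑ c ∈ A, Real.exp (predictor X ξ c) • X c

theorem sum_exp_mul_predictor (A : Finset (ℕ × ℕ)) (ξ η : Fin p → ℝ) :
    ∑ c ∈ A, Real.exp (predictor X ξ c) * predictor X η c
      = (∑ c ∈ A, Real.exp (predictor X ξ c) • X c) ⬝ᵥ η := by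
  rw [sum_dotProduct]
  exact Finset.sum_congr rfl fun c _ => by rw [smul_dotProduct]; rfl

theorem transpose_gram_inv :
    (((designMatrix k X)ᵀ * designMatrix k X)⁻¹)ᵀ
      = ((designMatrix k X)ᵀ * designMatrix k X)⁻¹ := by
  rw [Matrix.transpose_nonsing_inv, Matrix.transpose_mul, Matrix.transpose_transpose]

/-- Moving the symmetric matrix `(X'X)⁻¹` across the dot product exhibits the coefficients of `y` as
a vector in the column space of the design. -/
theorem sum_exp_mul_predictor_olsEstimator (A : Finset (ℕ × ℕ)) (ξ : Fin p → ℝ)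
    (y : upperTriangle k → ℝ) :
    ∑ c ∈ A, Real.exp (predictor X ξ c) * predictor X (olsEstimator k X y) c
      = ∑ c : upperTriangle k, predictor X (forecastGradient k X A ξ) c * y c := by
  rw [sum_exp_mul_predictor, olsEstimator, Matrix.dotProduct_mulVec, ← Matrix.mulVec_transpose,
    transpose_gram_inv, Matrix.dotProduct_mulVec, ← Matrix.mulVec_transpose,
    Matrix.transpose_transpose]
  rfl

theorem Identified.sum_predictor_forecastGradient_sq (hX : Identified k X) (A : Finset (ℕ × ℕ))
    (ξ : Fin p → ℝ) :
    ∑ c : upperTriangle k, predictor X (forecastGradient k X A ξ) c ^ 2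
      = estimationVar k X A ξ := by
  have h : ∑ c : upperTriangle k, predictor X (forecastGradient k X A ξ) c ^ 2
      = (designMatrix k X *ᵥ forecastGradient k X A ξ)
        ⬝ᵥ (designMatrix k X *ᵥ forecastGradient k X A ξ) := by
    simp only [sq]
    rfl
  rw [h, Matrix.dotProduct_mulVec, ← Matrix.mulVec_transpose, Matrix.mulVec_mulVec,
    forecastGradient, Matrix.mulVec_mulVec, Matrix.mul_nonsing_inv _ hX.isUnit_det,
    Matrix.one_mulVec, estimationVar]

/-- The extension by zero of an array of numbers on both triangles. -/
noncomputable def extendArray (u : allCells k → ℝ) (c : ℕ × ℕ) : ℝ :=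
  if h : c ∈ allCells k then u ⟨c, h⟩ else 0

theorem extendArray_coe (u : allCells k → ℝ) (c : allCells k) : extendArray u c = u c := by
  simp [extendArray]

theorem continuous_extendArray : Continuous (extendArray (k := k)) := by
  refine continuous_pi fun c => ?_
  unfold extendArray
  split_ifs <;> fun_prop

/-- The extension by zero of a vector on the upper triangle. -/
noncomputable def extendUpper (b : upperTriangle k → ℝ) (c : ℕ × ℕ) : ℝ :=
  if h : c ∈ upperTriangle k then b ⟨c, h⟩ else 0

theorem sum_extendUpper_mul (b : upperTriangle k → ℝ) (z : ℕ × ℕ → ℝ) :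
    ∑ c : allCells k, extendUpper b c * z c = ∑ c : upperTriangle k, b c * z c := by
  rw [Finset.sum_coe_sort (allCells k) (fun c => extendUpper b c * z c),
    Finset.sum_union (disjoint_upperTriangle_lowerTriangle k),
    Finset.sum_eq_zero (s := lowerTriangle k), add_zero,
    ← Finset.sum_coe_sort (upperTriangle k) (fun c => extendUpper b c * z c)]
  · exact Finset.sum_congr rfl fun c _ => by simp [extendUpper]
  · intro c hc
    have := Finset.disjoint_right.1 (disjoint_upperTriangle_lowerTriangle k) hc
    simp [extendUpper, this]

variable (k X) in
/-- The coefficients of the linear limit of the forecast error. -/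
noncomputable def errorWeights (A : Finset (ℕ × ℕ)) (ξ : Fin p → ℝ) (c : ℕ × ℕ) : ℝ :=
  (if c ∈ A then Real.exp (predictor X ξ c) else 0)
    - extendUpper (k := k) (fun c => predictor X (forecastGradient k X A ξ) c) c

theorem sum_errorWeights_mul {A : Finset (ℕ × ℕ)} (hA : A ⊆ lowerTriangle k) (ξ : Fin p → ℝ)
    (z : ℕ × ℕ → ℝ) :
    ∑ c : allCells k, errorWeights k X A ξ c * z c
      = ∑ c ∈ A, Real.exp (predictor X ξ c) * z c
        - ∑ c : upperTriangle k, predictor X (forecastGradient k X A ξ) c * z c := by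
  simp_rw [errorWeights, sub_mul]
  rw [Finset.sum_sub_distrib, sum_extendUpper_mul]
  congr 1
  rw [Finset.sum_coe_sort (allCells k)
    (fun c => (if c ∈ A then Real.exp (predictor X ξ c) else 0) * z c)]
  simp_rw [ite_mul, zero_mul]
  rw [Finset.sum_ite_mem, Finset.inter_eq_right.2 (hA.trans Finset.subset_union_right)]

theorem sum_errorWeights_mul_eq {A : Finset (ℕ × ℕ)} (hA : A ⊆ lowerTriangle k)
    (ξ : Fin p → ℝ) (z : ℕ × ℕ → ℝ) :
    ∑ c : allCells k, errorWeights k X A ξ c * z c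
      = ∑ c ∈ A, Real.exp (predictor X ξ c)
        * (z c - predictor X (olsEstimator k X fun c => z c) c) := by
  simp_rw [mul_sub]
  rw [sum_errorWeights_mul hA, Finset.sum_sub_distrib, sum_exp_mul_predictor_olsEstimator]

/-- The forecast cells and the observed cells are disjoint, so the two kinds of weight produce no
cross term. -/
theorem Identified.sum_errorWeights_sq (hX : Identified k X) {A : Finset (ℕ × ℕ)}
    (hA : A ⊆ lowerTriangle k) (ξ : Fin p → ℝ) :
    ∑ c : allCells k, errorWeights k X A ξ c ^ 2
      = processVar X A ξ + estimationVar k X A ξ := by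
  simp_rw [sq]
  rw [sum_errorWeights_mul hA, ← hX.sum_predictor_forecastGradient_sq, processVar, sub_eq_add_neg,
    ← Finset.sum_neg_distrib]
  congr 1
  · refine Finset.sum_congr rfl fun c hc => ?_
    have := Finset.disjoint_right.1 (disjoint_upperTriangle_lowerTriangle k) (hA hc)
    rw [errorWeights, if_pos hc, extendUpper, dif_neg this, sub_zero, two_mul, Real.exp_add]
  · refine Finset.sum_congr rfl fun c _ => ?_
    have : (c : ℕ × ℕ) ∉ A := fun h =>
      Finset.disjoint_right.1 (disjoint_upperTriangle_lowerTriangle k) (hA h) c.2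
    rw [errorWeights, if_neg this, extendUpper, dif_pos c.2]
    ring

/-- The residual directions vanish on the lower triangle, and on the upper one the error weights lie
in the column space; hence the orthogonality. -/
theorem Identified.exists_orthonormal_sSq (hX : Identified k X) {A : Finset (ℕ × ℕ)}
    (hA : A ⊆ lowerTriangle k) (ξ : Fin p → ℝ) (hpn : p < numObs k) :
    ∃ b : Fin (numObs k - p) → allCells k → ℝ, (Orthonormal ℝ fun i => WithLp.toLp 2 (b i)) ∧
      (∀ i, ∑ c : allCells k, errorWeights k X A ξ c * b i c = 0) ∧
      ∀ u, sSq k X (fun c => extendArray u c)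
        = (∑ i, (∑ c, b i c * u c) ^ 2) / ((numObs k - p : ℕ) : ℝ) := by
  obtain ⟨b, hb, hort, hrss⟩ := hX.exists_orthonormal_rss
  refine ⟨fun i c => extendUpper (b i) c, ?_, fun i => ?_, fun u => ?_⟩
  · rw [orthonormal_iff_ite] at hb ⊢
    intro i j
    rw [← hb i j]
    simp only [PiLp.inner_apply, RCLike.inner_apply, conj_trivial]
    rw [sum_extendUpper_mul (b j) (extendUpper (b i))]
    exact Finset.sum_congr rfl fun c _ => by simp [extendUpper]
  · rw [sum_errorWeights_mul hA, Finset.sum_eq_zero, zero_sub, neg_eq_zero, ← hort i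
      (forecastGradient k X A ξ)]
    · exact Finset.sum_congr rfl fun c _ => by simp [extendUpper, mul_comm]
    · intro c hc
      have := Finset.disjoint_right.1 (disjoint_upperTriangle_lowerTriangle k) (hA hc)
      simp [extendUpper, this]
  · rw [sSq, hrss, Nat.cast_sub hpn.le]
    congr 1
    refine Finset.sum_congr rfl fun i _ => ?_
    rw [← sum_extendUpper_mul]
    simp_rw [extendArray_coe]

theorem Identified.ae_sSq_pos (hX : Identified k X) (hpn : p < numObs k) :
    ∀ᵐ u ∂(Measure.pi fun _ : allCells k => gaussianReal 0 1),
      0 < sSq k X fun c => extendArray u c := by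
  obtain ⟨b, hb, -, hs⟩ := hX.exists_orthonormal_sSq (Finset.empty_subset _) 0 hpn
  filter_upwards [ae_sum_sq_pos_of_orthonormal (Nat.sub_pos_of_lt hpn) hb] with u hu
  rw [hs]
  exact div_pos hu (Nat.cast_pos.2 (Nat.sub_pos_of_lt hpn))

/-- The limit of the studentized forecast error has a scaled `t` distribution. -/
theorem Identified.map_studentizedExpansion_zero (hX : Identified k X) {A : Finset (ℕ × ℕ)}
    (hA : A ⊆ lowerTriangle k) (ξ : Fin p → ℝ) (hpn : p < numObs k) :
    (Measure.pi fun _ : allCells k => gaussianReal 0 1).map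
        (fun u => studentizedExpansion k X ξ A 0 (extendArray u))
      = (studentT (numObs k - p)).map
        (fun t => √(processVar X A ξ + estimationVar k X A ξ) * t) := by
  obtain ⟨b, hb, hvb, hs⟩ := hX.exists_orthonormal_sSq hA ξ hpn
  have hsq := hX.sum_errorWeights_sq hA ξ
  set σ := √(processVar X A ξ + estimationVar k X A ξ)
  have hnn : 0 ≤ processVar X A ξ + estimationVar k X A ξ := by
    rw [← hsq]
    positivity
  have e : (fun u => studentizedExpansion k X ξ A 0 (extendArray u))
      = fun u => (∑ c : allCells k, errorWeights k X A ξ c * u c)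
        / √((∑ i, (∑ c, b i c * u c) ^ 2) / ((numObs k - p : ℕ) : ℝ)) := by
    funext u
    rw [studentizedExpansion_zero, hs, ← sum_errorWeights_mul_eq hA, inv_mul_eq_div]
    simp_rw [extendArray_coe]
  rw [e]
  rcases eq_or_ne σ 0 with h0 | h0
  -- The degenerate case, as for empty `A`: both laws are the point mass at `0`.
  · have hz : ∀ c : allCells k, errorWeights k X A ξ c = 0 := fun c => by
      rw [(Real.sqrt_eq_zero hnn).1 h0] at hsq
      exact pow_eq_zero_iff two_ne_zero |>.1
        ((Finset.sum_eq_zero_iff_of_nonneg fun c _ => sq_nonneg _).1 hsq c (Finset.mem_univ c))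
    simp [h0, hz]
  · have hσ : 0 < σ := lt_of_le_of_ne (Real.sqrt_nonneg _) (Ne.symm h0)
    have hn : ‖WithLp.toLp 2 fun c : allCells k => σ⁻¹ * errorWeights k X A ξ c‖ = 1 := by
      rw [← sq_eq_sq₀ (norm_nonneg _) zero_le_one, EuclideanSpace.real_norm_sq_eq]
      simp only [mul_pow]
      rw [← Finset.mul_sum, hsq, ← Real.sq_sqrt hnn]
      change σ⁻¹ ^ 2 * σ ^ 2 = _
      field_simp
    rw [← map_studentized_of_orthonormal hn hb, Measure.map_map (by fun_prop) (by fun_prop)]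
    · congr 1
      funext u
      simp only [Function.comp_apply, mul_assoc]
      rw [← Finset.mul_sum]
      field_simp
    · intro i
      simp only [mul_assoc]
      rw [← Finset.mul_sum, hvb, mul_zero]

end LimitLaw

/-! ### Convergence of the forecast error and of the variance estimators -/

section Convergence

variable {p k : ℕ} {X : ℕ × ℕ → Fin p → ℝ} {ι : Type*} {l : Filter ι} {Ω : ι → Type*}
  [∀ τ, MeasurableSpace (Ω τ)] {P : (τ : ι) → Measure (Ω τ)}
  {Y : (τ : ι) → ℕ × ℕ → Ω τ → ℝ} {ξ : Fin p → ℝ} {ω : ι → ℝ}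

theorem GeneralizedLogNormal.eq_scaledClaims
    (hY : GeneralizedLogNormal k (allCells k) X ξ ω l P Y) (τ : ι) (w : Ω τ) {c : ℕ × ℕ}
    (hc : c ∈ allCells k) :
    Y τ c w = scaledClaims X ξ (ω τ) (extendArray fun c : allCells k =>
      (Y τ c w - ∫ w', Y τ c w' ∂(P τ)) / (ω τ * ∫ w', Y τ c w' ∂(P τ))) c := by
  have hm := hY.mean_pos τ c hc
  have hω := hY.omega_pos τ
  rw [scaledClaims, ← hY.log_mean τ c hc, Real.exp_log hm,
    extendArray_coe (k := k) (c := ⟨c, hc⟩)]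
  dsimp only
  field_simp
  ring

theorem GeneralizedLogNormal.logData_eq
    (hY : GeneralizedLogNormal k (allCells k) X ξ ω l P Y) (τ : ι) (w : Ω τ) :
    logData k (Y τ) w = logUpper k (scaledClaims X ξ (ω τ) (extendArray fun c : allCells k =>
      (Y τ c w - ∫ w', Y τ c w' ∂(P τ)) / (ω τ * ∫ w', Y τ c w' ∂(P τ)))) := by
  funext c
  rw [logData, logUpper, ← hY.eq_scaledClaims τ w (Finset.mem_union_left _ c.2)]

theorem GeneralizedLogNormal.measurable_logData
    (hY : GeneralizedLogNormal k (allCells k) X ξ ω l P Y) (τ : ι) :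
    Measurable (logData k (Y τ)) :=
  measurable_pi_lambda _ fun c =>
    Real.measurable_log.comp (hY.measurable τ c (Finset.mem_union_left _ c.2))

/-- Near `ω = 0` all arguments of the logarithm are positive, so the value of `log` elsewhere cannot
affect the limit. -/
theorem eventually_one_add_mul_pos (z : allCells k → ℝ) :
    ∀ᶠ x : ℝ × (allCells k → ℝ) in 𝓝 (0, z),
      ∀ c ∈ upperTriangle k, 0 < 1 + x.1 * extendArray x.2 c := by
  refine (Finset.eventually_all _).2 fun c _ => ?_
  have h : Continuous fun x : ℝ × (allCells k → ℝ) => 1 + x.1 * extendArray x.2 c :=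
    continuous_const.add (continuous_fst.mul
      ((continuous_apply c).comp (continuous_extendArray.comp continuous_snd)))
  exact h.continuousAt.eventually (lt_mem_nhds (by simp))

theorem continuousAt_prodMk_extendArray (z : allCells k → ℝ) :
    ContinuousAt (fun x : ℝ × (allCells k → ℝ) => (x.1, extendArray x.2)) (0, z) :=
  (continuous_fst.prodMk (continuous_extendArray.comp continuous_snd)).continuousAt

variable [l.IsCountablyGenerated] [∀ τ, IsProbabilityMeasure (P τ)]

theorem GeneralizedLogNormal.tendstoInProbability_comp_olsEstimator
    (hY : GeneralizedLogNormal k (allCells k) X ξ ω l P Y) {H : (Fin p → ℝ) → ℝ}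
    (hH : Continuous H) :
    TendstoInProbability (fun τ w => H (olsEstimator k X (logData k (Y τ) w))) l (H ξ) P := by
  refine tendstoInProbability_of_tendstoInDistribution_const
    (P' := Measure.pi fun _ : allCells k => gaussianReal 0 1) ?_
  refine tendstoInDistribution_of_ae_continuousAt hY.tendstoInDistribution_standardized
    (fun τ => ((hH.comp continuous_olsEstimator).measurable.comp
      (hY.measurable_logData τ)).aemeasurable)
    aemeasurable_const
    -- The first branch is the actual statistic, the second its extension to `ω ≤ 0`. They agree
    -- near `(0, z)` when `ω > 0`, so continuity of the extension suffices.
    (fun x => if 0 < x.1 then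
      H (olsEstimator k X (logUpper k (scaledClaims X ξ x.1 (extendArray x.2))))
      else H (ξ + x.1 • olsEstimator k X (scaledErrors k x.1 (extendArray x.2))))
    (fun τ w => ?_) (Eventually.of_forall fun z => ?_) (Eventually.of_forall fun z => by simp)
  · rw [if_pos (hY.omega_pos τ), hY.logData_eq]
  · have h : ContinuousAt (fun x : ℝ × (allCells k → ℝ) =>
        H (ξ + x.1 • olsEstimator k X (scaledErrors k x.1 (extendArray x.2)))) (0, z) :=
      hH.continuousAt.comp (continuousAt_const.add (continuousAt_fst.smul
        (continuous_olsEstimator.continuousAt.comp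
          (ContinuousAt.comp (x := ((0 : ℝ), z))
            (g := fun x : ℝ × (ℕ × ℕ → ℝ) => scaledErrors k x.1 x.2)
            (continuousAt_scaledErrors _) (continuousAt_prodMk_extendArray z)))))
    refine h.congr ?_
    filter_upwards [eventually_one_add_mul_pos z] with x hx
    split_ifs
    · rw [logUpper_scaledClaims ξ hx, hY.identified.olsEstimator_add_smul]
    · rfl

theorem GeneralizedLogNormal.tendstoInDistribution_studentizedError
    (hY : GeneralizedLogNormal k (allCells k) X ξ ω l P Y) (hpn : p < numObs k)
    {A : Finset (ℕ × ℕ)} (hA : A ⊆ lowerTriangle k) :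
    TendstoInDistribution
      (fun τ w => (√(sSq k X (logData k (Y τ) w)))⁻¹ *
        (∑ c ∈ A, Y τ c w - pointForecast k X A (logData k (Y τ) w)))
      l (fun t : ℝ => √(processVar X A ξ + estimationVar k X A ξ) * t)
      P (studentT (numObs k - p)) := by
  have hlim : AEMeasurable (fun u : allCells k → ℝ =>
      studentizedExpansion k X ξ A 0 (extendArray u))
      (Measure.pi fun _ : allCells k => gaussianReal 0 1) := by
    simp_rw [studentizedExpansion_zero]
    have hz : Continuous fun (u : allCells k → ℝ) (c : upperTriangle k) => extendArray u c :=
      continuous_pi fun c => (continuous_apply (c : ℕ × ℕ)).comp continuous_extendArray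
    refine Measurable.aemeasurable (Measurable.mul ?_ (Continuous.measurable ?_))
    · exact (Real.continuous_sqrt.comp (continuous_sSq.comp hz)).measurable.inv
    · exact continuous_finsetSum _ fun c _ => continuous_const.mul
        (((continuous_apply c).comp continuous_extendArray).sub
          ((continuous_predictor c).comp (continuous_olsEstimator.comp hz)))
  have hmeas : ∀ τ, AEMeasurable (fun w => (√(sSq k X (logData k (Y τ) w)))⁻¹ *
      (∑ c ∈ A, Y τ c w - pointForecast k X A (logData k (Y τ) w))) (P τ) := fun τ => by
    have h1 := hY.measurable_logData τ
    refine Measurable.aemeasurable (Measurable.mul ?_ (Measurable.sub ?_ ?_))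
    · exact ((Real.continuous_sqrt.comp continuous_sSq).measurable.comp h1).inv
    · exact Finset.measurable_sum _ fun c hc =>
        hY.measurable τ c (Finset.mem_union_right _ (hA hc))
    · exact (continuous_pointForecast A).measurable.comp h1
  have key := tendstoInDistribution_of_ae_continuousAt hY.tendstoInDistribution_standardized
    hmeas hlim
    (fun x => if 0 < x.1 then studentizedError k X A (scaledClaims X ξ x.1 (extendArray x.2))
      else studentizedExpansion k X ξ A x.1 (extendArray x.2))
    (fun τ w => ?_) ?_ (Eventually.of_forall fun z => by simp)
  · refine ⟨hmeas, by fun_prop, ?_⟩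
    -- The limit obtained lives on Gaussian space; only its law matters, and that is the scaled `t`
    -- law.
    convert key.tendsto using 3
    exact congrArg 𝓝 (Subtype.ext (hY.identified.map_studentizedExpansion_zero hA ξ hpn).symm)
  · rw [if_pos (hY.omega_pos τ), studentizedError, ← hY.logData_eq]
    congr 2
    exact Finset.sum_congr rfl fun c hc =>
      hY.eq_scaledClaims τ w (Finset.mem_union_right _ (hA hc))
  · filter_upwards [hY.identified.ae_sSq_pos hpn] with z hz
    have h : ContinuousAt (fun x : ℝ × (allCells k → ℝ) =>
        studentizedExpansion k X ξ A x.1 (extendArray x.2)) (0, z) := by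
      have h0 := continuousAt_studentizedExpansion (z := extendArray z) ξ A hz
      exact ContinuousAt.comp_of_eq
        (f := fun x : ℝ × (allCells k → ℝ) => (x.1, extendArray x.2))
        h0 (continuousAt_prodMk_extendArray z) rfl
    refine h.congr ?_
    filter_upwards [eventually_one_add_mul_pos z] with x hx
    split_ifs with hpos
    · rw [hY.identified.studentizedError_scaledClaims ξ A hpos hx]
    · rfl

end Convergence

end LogNormalCL

theorem theorem8 {k p : ℕ} (hpn : p < LogNormalCL.numObs k)
    (X : ℕ × ℕ → Fin p → ℝ) (ξ : Fin p → ℝ)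
    {ι : Type*} (l : Filter ι) [l.IsCountablyGenerated] (ω : ι → ℝ)
    {Ω : ι → Type*} [∀ τ, MeasurableSpace (Ω τ)]
    (P : (τ : ι) → Measure (Ω τ)) [∀ τ, IsProbabilityMeasure (P τ)]
    (Y : (τ : ι) → ℕ × ℕ → Ω τ → ℝ)
    (hY : LogNormalCL.GeneralizedLogNormal k
      (LogNormalCL.upperTriangle k ∪ LogNormalCL.lowerTriangle k) X ξ ω l P Y)
    (A : Finset (ℕ × ℕ)) (hA : A ⊆ LogNormalCL.lowerTriangle k) :
    TendstoInDistribution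
      (fun τ w => (√(LogNormalCL.sSq k X (LogNormalCL.logData k (Y τ) w)))⁻¹ *
        (∑ c ∈ A, Y τ c w - LogNormalCL.pointForecast k X A (LogNormalCL.logData k (Y τ) w)))
      l
      (fun t : ℝ =>
        √(LogNormalCL.processVar X A ξ + LogNormalCL.estimationVar k X A ξ) * t)
      P (LogNormalCL.studentT (LogNormalCL.numObs k - p)) ∧
    LogNormalCL.TendstoInProbability
      (fun τ w => LogNormalCL.processVar X A
        (LogNormalCL.olsEstimator k X (LogNormalCL.logData k (Y τ) w)))
      l (LogNormalCL.processVar X A ξ) P ∧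
    LogNormalCL.TendstoInProbability
      (fun τ w => LogNormalCL.estimationVar k X A
        (LogNormalCL.olsEstimator k X (LogNormalCL.logData k (Y τ) w)))
      l (LogNormalCL.estimationVar k X A ξ) P :=
  ⟨hY.tendstoInDistribution_studentizedError hpn hA,
    hY.tendstoInProbability_comp_olsEstimator (LogNormalCL.continuous_processVar A),
    hY.tendstoInProbability_comp_olsEstimator (LogNormalCL.continuous_estimationVar A)⟩
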